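/- Let $A\in\mathbb R^{n\times n}$ be invertible, let $D\ge 0$ and $B_\tau,C_\tau\in\mathbb R^{n\times m}$, $\sigma_\tau\in\mathbb R$ for $0\le\tau\le D$. Let $\omega_t=(\omega_t^0,\dots,\omega_t^D)'$, $t\ge 0$, be independent and identically distributed square-integrable random vectors with $\mathbf E(\omega_t^\tau)=0$ and $\mathbf E(\omega_t^\tau\omega_t^\rho)=\sigma_\tau^2\delta_{\tau\rho}$, and let $\mathcal F_t$ be the $\sigma$-algebra generated by $\omega_0,\dots,\omega_t$ ($\mathcal F_{-1}$ is trivial). Consider the multi-delay system $$x_{t+1}=Ax_t+\sum_{\tau=0}^D\left(B_\tau+\omega_t^\tau C_\tau\right)u_{t-\tau},\qquad t\ge 0,\tag{1}$$ with state $x_t\in\mathbb R^n$, input $u_t\in\mathbb R^m$ and deterministic initial values $x_0,u_{-1},\dots,u_{-D}$. System (1) is called asymptotically mean-square stabilizable if there are constant matrices $K_0\in\mathbb R^{m\times n}$ and $K_1,\dots,K_D\in\mathbb R^{m\times m}$ such that, for all initial values, the feedback $u_t=K_0x_t+\sum_{\tau=1}^DK_\tau u_{t-\tau}$, $t\ge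 0$, is admissible, that is, $u_t$ is $\mathcal F_{t-1}$-measurable and $\sum_{t=0}^\infty\mathbf E(u_t'u_t)<\infty$, and the resulting state satisfies $\lim_{t\to\infty}\mathbf E(x_t'x_t)=0$. Put $L=\sum_{j=0}^DA^{D-j}B_j$. For square matrices, $Q>0$ means that $Q$ is symmetric positive definite, and $Q_1>Q_2$ means $Q_1-Q_2>0$. Then the following statements are equivalent. (a) System (1) is asymptotically mean-square stabilizable. (b) The delay-free system $\beta_{t+1}=A\beta_t+Lv_t+\sum_{\tau=0}^D\omega_t^\tau A^DC_\tau v_t$ is asymptotically mean-square stabilizable by state feedback: there is $K\in\mathbb R^{m\times n}$ such that, with $v_t=K\beta_t$, $\lim_{t\to\infty}\mathbf E(\beta_t'\beta_t)=0$ for every deterministic initial value $\beta_0\in\mathbb R^n$. (c) For every $Q>0$ there exist $K\in\mathbb R^{m\times n}$ and $P>0$ in $\mathbb R^{n\times n}$ satisfying $$P=Q+(A+LK)'P(A+LK)+\sum_{\tau=0}^D\sigma_\tau^2K'C_\tau'(A')^DPA^DC_\tau K.$$ (d) There exist $K\in\mathbb R^{m\times n}$ and $P>0$ in $\mathbb R^{n\times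 n}$ satisfying $$P>(A+LK)'P(A+LK)+\sum_{\tau=0}^D\sigma_\tau^2K'C_\tau'(A')^DPA^DC_\tau K.$$ -/

import Mathlib

open MeasureTheory ProbabilityTheory Filter Topology
open scoped Matrix ENNReal

noncomputable section

namespace DelayStab

/-- The noise: `ω t p τ` is the value of the scalar `ω_t^τ` at the sample point `p`. The random
vectors `ω t` are independent and identically distributed in `t`, square integrable, of mean zero;
the component `τ` has variance `σ_τ²` and different components are uncorrelated. -/
structure IsNoise {Ω : Type*} [MeasurableSpace Ω] (μ : Measure Ω) {D : ℕ}
    (σ : Fin (D + 1) → ℝ) (ω : ℕ → Ω → Fin (D + 1) → ℝ) : Prop where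
  measurable : ∀ t, Measurable (ω t)
  indep : iIndepFun ω μ
  identDistrib : ∀ t, IdentDistrib (ω t) (ω 0) μ μ
  memLp : ∀ t τ, MemLp (fun p => ω t p τ) 2 μ
  mean : ∀ t τ, ∫ p, ω t p τ ∂μ = 0
  covariance : ∀ t τ ρ, ∫ p, ω t p τ * ω t p ρ ∂μ = if τ = ρ then σ τ ^ 2 else 0

/-- The σ-algebra `ℱ_{t-1}` generated by `ω_0, …, ω_{t-1}` (trivial for `t = 0`). -/
abbrev past {Ω : Type*} {D : ℕ} (ω : ℕ → Ω → Fin (D + 1) → ℝ) (t : ℕ) : MeasurableSpace Ω :=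
  ⨆ s ∈ Finset.range t, MeasurableSpace.comap (ω s) inferInstance

/-- `E (X' X)`, as an extended nonnegative number. -/
def meanSquare {Ω : Type*} [MeasurableSpace Ω] (μ : Measure Ω) {k : ℕ}
    (X : Ω → Fin k → ℝ) : ℝ≥0∞ :=
  ∫⁻ p, ENNReal.ofReal (X p ⬝ᵥ X p) ∂μ

/-- `x` and `u` are the state and the input of the multi-delay system
`x_{t+1} = A x_t + ∑_{τ=0}^D (B_τ + ω_t^τ C_τ) u_{t-τ}`, `t ≥ 0`, in closed loop with the feedback
`u_t = K₀ x_t + ∑_{τ=1}^D K_τ u_{t-τ}`, `t ≥ 0`, for the initial state `x₀` and the initial inputs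
`u_{-τ} = φ_τ`, `1 ≤ τ ≤ D`. An index `k : Fin D` stands for `τ = k + 1`. Inputs before the time
`-D` do not enter. -/
structure IsClosedLoop {Ω : Type*} {n m D : ℕ} (A : Matrix (Fin n) (Fin n) ℝ)
    (B C : Fin (D + 1) → Matrix (Fin n) (Fin m) ℝ) (ω : ℕ → Ω → Fin (D + 1) → ℝ)
    (K₀ : Matrix (Fin m) (Fin n) ℝ) (K : Fin D → Matrix (Fin m) (Fin m) ℝ)
    (x₀ : Fin n → ℝ) (φ : Fin D → Fin m → ℝ)
    (x : ℕ → Ω → Fin n → ℝ) (u : ℤ → Ω → Fin m → ℝ) : Prop where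
  init_state : ∀ p, x 0 p = x₀
  init_input : ∀ (k : Fin D) (p : Ω), u (-((k : ℤ) + 1)) p = φ k
  dynamics : ∀ (t : ℕ) (p : Ω), x (t + 1) p =
    A *ᵥ x t p + ∑ τ : Fin (D + 1), (B τ + ω t p τ • C τ) *ᵥ u ((t : ℤ) - (τ : ℤ)) p
  feedback : ∀ (t : ℕ) (p : Ω), u (t : ℤ) p =
    K₀ *ᵥ x t p + ∑ k : Fin D, K k *ᵥ u ((t : ℤ) - ((k : ℤ) + 1)) p

/-- The multi-delay system is asymptotically mean-square stabilizable: there are gains such that,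
for all initial values, the feedback input is admissible (it is `ℱ_{t-1}`-measurable and
`∑_{t ≥ 0} E (u_t' u_t) < ∞`) and `E (x_t' x_t) → 0`. -/
def IsStabilizable {Ω : Type*} [MeasurableSpace Ω] (μ : Measure Ω) {n m D : ℕ}
    (A : Matrix (Fin n) (Fin n) ℝ) (B C : Fin (D + 1) → Matrix (Fin n) (Fin m) ℝ)
    (ω : ℕ → Ω → Fin (D + 1) → ℝ) : Prop :=
  ∃ (K₀ : Matrix (Fin m) (Fin n) ℝ) (K : Fin D → Matrix (Fin m) (Fin m) ℝ),
    ∀ (x₀ : Fin n → ℝ) (φ : Fin D → Fin m → ℝ)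
      (x : ℕ → Ω → Fin n → ℝ) (u : ℤ → Ω → Fin m → ℝ),
      IsClosedLoop A B C ω K₀ K x₀ φ x u →
        (∀ t : ℕ, Measurable[past ω t] (u (t : ℤ))) ∧
        ∑' t : ℕ, meanSquare μ (u (t : ℤ)) < ∞ ∧
        Tendsto (fun t : ℕ => meanSquare μ (x t)) atTop (𝓝 0)

/-- The closed-loop state of the delay-free system
`β_{t+1} = A β_t + L v_t + ∑_{τ=0}^D ω_t^τ A^D C_τ v_t` with `v_t = K β_t`. -/
def delayFreeState {Ω : Type*} {n m D : ℕ} (A : Matrix (Fin n) (Fin n) ℝ)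
    (L : Matrix (Fin n) (Fin m) ℝ) (C : Fin (D + 1) → Matrix (Fin n) (Fin m) ℝ)
    (ω : ℕ → Ω → Fin (D + 1) → ℝ) (K : Matrix (Fin m) (Fin n) ℝ) (β₀ : Fin n → ℝ) :
    ℕ → Ω → Fin n → ℝ
  | 0, _ => β₀
  | t + 1, p =>
    let β := delayFreeState A L C ω K β₀ t p
    let v := K *ᵥ β
    A *ᵥ β + L *ᵥ v + ∑ τ : Fin (D + 1), ω t p τ • ((A ^ D * C τ) *ᵥ v)

/-- The delay-free system is asymptotically mean-square stabilizable by a state feedback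
`v_t = K β_t`. -/
def IsDelayFreeStabilizable {Ω : Type*} [MeasurableSpace Ω] (μ : Measure Ω) {n m D : ℕ}
    (A : Matrix (Fin n) (Fin n) ℝ) (L : Matrix (Fin n) (Fin m) ℝ)
    (C : Fin (D + 1) → Matrix (Fin n) (Fin m) ℝ) (ω : ℕ → Ω → Fin (D + 1) → ℝ) : Prop :=
  ∃ K : Matrix (Fin m) (Fin n) ℝ, ∀ β₀ : Fin n → ℝ,
    Tendsto (fun t : ℕ => meanSquare μ (delayFreeState A L C ω K β₀ t)) atTop (𝓝 0)

/-- `L = ∑_{j=0}^D A^{D-j} B_j`. -/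
def reducedInput {n m D : ℕ} (A : Matrix (Fin n) (Fin n) ℝ)
    (B : Fin (D + 1) → Matrix (Fin n) (Fin m) ℝ) : Matrix (Fin n) (Fin m) ℝ :=
  ∑ j : Fin (D + 1), A ^ (D - (j : ℕ)) * B j

/-- `(A + L K)' P (A + L K) + ∑_{τ=0}^D σ_τ² K' C_τ' (A')^D P A^D C_τ K`. -/
def lyapunovMap {n m D : ℕ} (A : Matrix (Fin n) (Fin n) ℝ) (L : Matrix (Fin n) (Fin m) ℝ)
    (C : Fin (D + 1) → Matrix (Fin n) (Fin m) ℝ) (σ : Fin (D + 1) → ℝ)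
    (K : Matrix (Fin m) (Fin n) ℝ) (P : Matrix (Fin n) (Fin n) ℝ) : Matrix (Fin n) (Fin n) ℝ :=
  (A + L * K)ᵀ * P * (A + L * K) +
    ∑ τ : Fin (D + 1), σ τ ^ 2 • (Kᵀ * (C τ)ᵀ * Aᵀ ^ D * P * A ^ D * C τ * K)

/-- For all gains and initial values the closed loop has a trajectory, so that the quantification
over trajectories above is never empty. -/
theorem exists_isClosedLoop {Ω : Type*} {n m D : ℕ} (A : Matrix (Fin n) (Fin n) ℝ)
    (B C : Fin (D + 1) → Matrix (Fin n) (Fin m) ℝ) (ω : ℕ → Ω → Fin (D + 1) → ℝ)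
    (K₀ : Matrix (Fin m) (Fin n) ℝ) (K : Fin D → Matrix (Fin m) (Fin m) ℝ)
    (x₀ : Fin n → ℝ) (φ : Fin D → Fin m → ℝ) :
    ∃ (x : ℕ → Ω → Fin n → ℝ) (u : ℤ → Ω → Fin m → ℝ), IsClosedLoop A B C ω K₀ K x₀ φ x u := by
  -- the state together with the whole sequence of inputs, the current one at index 0
  let ext : (Fin n → ℝ) → (ℕ → Fin m → ℝ) → ℕ → Fin m → ℝ := fun x h j =>
    Nat.casesOn j (K₀ *ᵥ x + ∑ k : Fin D, K k *ᵥ h k) (fun i => h i)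
  let S : ℕ → Ω → (Fin n → ℝ) × (ℕ → Fin m → ℝ) := fun t p =>
    Nat.rec (x₀, ext x₀ fun k => if hk : k < D then φ ⟨k, hk⟩ else 0)
      (fun s y =>
        let x' := A *ᵥ y.1 + ∑ τ : Fin (D + 1), (B τ + ω s p τ • C τ) *ᵥ y.2 τ
        (x', ext x' y.2)) t
  let u : ℤ → Ω → Fin m → ℝ := fun t p => (S t.toNat p).2 (-t).toNat
  have hu : ∀ (t j : ℕ) (p : Ω), u ((t : ℤ) - j) p = (S t p).2 j := by
    intro t
    induction t with
    | zero =>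
      intro j p
      have h1 : ((0 : ℕ) - j : ℤ).toNat = 0 := by omega
      have h2 : (-((0 : ℕ) - j : ℤ)).toNat = j := by omega
      simp only [u, h1, h2]
    | succ t ih =>
      intro j p
      cases j with
      | zero =>
        have h1 : (((t + 1 : ℕ) : ℤ) - (0 : ℕ)).toNat = t + 1 := by omega
        have h2 : (-(((t + 1 : ℕ) : ℤ) - (0 : ℕ))).toNat = 0 := by omega
        simp only [u, h1, h2]
      | succ i =>
        have h1 : ((t + 1 : ℕ) : ℤ) - ((i + 1 : ℕ) : ℤ) = (t : ℤ) - i := by push_cast; ring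
        rw [h1, ih i p]
  refine ⟨fun t p => (S t p).1, u, ?_, ?_, ?_, ?_⟩
  · intro p
    rfl
  · intro k p
    have h := hu 0 (k + 1) p
    have h1 : ((0 : ℕ) : ℤ) - ((k + 1 : ℕ) : ℤ) = -((k : ℤ) + 1) := by push_cast; ring
    rw [h1] at h
    rw [h]
    change (if hk : (k : ℕ) < D then φ ⟨k, hk⟩ else 0) = φ k
    simp
  · intro t p
    simp only [hu]
    rfl
  · intro t p
    have h0 := hu t 0 p
    simp only [Nat.cast_zero, sub_zero] at h0
    have hk : ∀ k : Fin D, u ((t : ℤ) - ((k : ℤ) + 1)) p = (S t p).2 (k + 1) := by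
      intro k
      have h := hu t (k + 1) p
      push_cast at h
      exact h
    simp only [h0, hk]
    cases t <;> rfl

end DelayStab

end

/-!
The delays are removed by passing to the reduced state
`β_t = A^D x_t + ∑_{k < D} (∑_{τ > k} A^{D+k-τ} B_τ) u_{t-1-k}`, which satisfies
`β_{t+1} = A β_t + L u_t + ∑_τ ω_t^τ A^D C_τ u_{t-τ}` (`reducedState_succ`): only the noise terms are
still delayed. The fresh noise is independent of everything before it, so that it contributes to
second moments without interference (`crossMoment_add_noise`), and the remaining delays can be
absorbed: adding to `E (β_t β_t')` the second moments of the noise contributions that earlier inputs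
will still make gives the stored moments `R_t` (`storedMoment`), whose one-step balance
`storedMoment_succ` is that of a system without delays.

* A feedback `K` with a Lyapunov matrix `P` for the delay-free system is applied to the reduced
  state, `u_t = K β_t`. Then `tr (P R_t)` decreases by at least a multiple of `E (β_t' β_t)` in each
  step, so that these are summable (`isStabilizable_of_posDef_sub`).
* Conversely, summing the balance of a stabilized closed loop over a long finite horizon, and over
  trajectories whose initial reduced states form a basis, gives a joint second-moment matrix of
  state and input, with blocks `S`, `G'`, `G`, `U`, that satisfies a strict inequality. The gain
  `K = G S⁻¹` of the best linear prediction of `u` by `β` turns it into `S > 𝒯 S`, where `𝒯` is the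
  second-moment map of the delay-free closed loop
  (`exists_posDef_sub_of_joint`, `IsStabilizable.isDelayFreeStabilizable`).

For the delay-free system everything is a statement on the completely positive map
`𝒯 X = ∑ᵢ Fᵢ X Fᵢ'` and its adjoint, the Lyapunov map: a strict inequality `P > 𝒯 P` with `P > 0`
forces geometric decay of the iterates (`exists_geometric_bound`), the Neumann series then solves
the Lyapunov equation (`exists_lyapunov_solution`), and decay of the iterates gives back a strict
inequality by a partial sum of the series (`exists_posDef_sub_krausMap`).
-/

open MeasureTheory ProbabilityTheory Filter Topology
open scoped Matrix ENNReal

noncomputable section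

namespace DelayStab

/-! ### Real positive semidefinite matrices -/

section PosSemidef

variable {n m : ℕ}

theorem posSemidef_iff {M : Matrix (Fin n) (Fin n) ℝ} :
    M.PosSemidef ↔ M.IsHermitian ∧ ∀ x, 0 ≤ x ⬝ᵥ (M *ᵥ x) := by
  simpa only [star_trivial] using Matrix.posSemidef_iff_dotProduct_mulVec (M := M)

theorem posDef_iff {M : Matrix (Fin n) (Fin n) ℝ} :
    M.PosDef ↔ M.IsHermitian ∧ ∀ x, x ≠ 0 → 0 < x ⬝ᵥ (M *ᵥ x) := by
  simpa only [star_trivial] using Matrix.posDef_iff_dotProduct_mulVec (M := M)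

theorem posSemidef_conj {M : Matrix (Fin n) (Fin n) ℝ} (hM : M.PosSemidef)
    (F : Matrix (Fin m) (Fin n) ℝ) : (F * M * Fᵀ).PosSemidef := by
  simpa only [Matrix.conjTranspose_eq_transpose_of_trivial] using
    hM.mul_mul_conjTranspose_same F

open scoped MatrixOrder in
theorem exists_eq_transpose_mul_self {M : Matrix (Fin n) (Fin n) ℝ} (hM : M.PosSemidef) :
    ∃ B : Matrix (Fin n) (Fin n) ℝ, M = Bᵀ * B := by
  obtain ⟨B, hB⟩ := CStarAlgebra.nonneg_iff_eq_star_mul_self.mp hM.nonneg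
  exact ⟨B, by rw [hB, Matrix.star_eq_conjTranspose, Matrix.conjTranspose_eq_transpose_of_trivial]⟩

theorem abs_apply_le_trace {M : Matrix (Fin n) (Fin n) ℝ} (hM : M.PosSemidef) (i j : Fin n) :
    |M i j| ≤ M.trace := by
  have hd : ∀ k, M k k ≤ M.trace := fun k =>
    Finset.single_le_sum (f := fun k => M k k) (fun l _ => hM.diag_nonneg) (Finset.mem_univ k)
  have hsym : M j i = M i j := by simpa using hM.isHermitian.apply i j
  have key : ∀ s : ℝ, 0 ≤ M i i + s * M i j + (s * M j i + s * s * M j j) := by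
    intro s
    have h := (posSemidef_iff.1 hM).2 (Pi.single i 1 + s • Pi.single j 1)
    simp [Matrix.mulVec_add, Matrix.mulVec_smul, add_dotProduct, dotProduct_add] at h
    linarith
  have h1 := key 1
  have h2 := key (-1)
  have := hd i
  have := hd j
  rw [hsym] at h1 h2
  rw [abs_le]
  constructor <;> linarith

/-- A positive semidefinite matrix is at most its trace times the identity: with `M = B'B` this is
the Cauchy–Schwarz inequality for the rows of `B`. -/
theorem trace_smul_one_sub_posSemidef {M : Matrix (Fin n) (Fin n) ℝ} (hM : M.PosSemidef) :
    (M.trace • (1 : Matrix (Fin n) (Fin n) ℝ) - M).PosSemidef := by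
  refine posSemidef_iff.2 ⟨?_, fun x => ?_⟩
  · exact (Matrix.isHermitian_one.smul (IsSelfAdjoint.all _)).sub hM.isHermitian
  · obtain ⟨B, rfl⟩ := exists_eq_transpose_mul_self hM
    rw [Matrix.sub_mulVec, dotProduct_sub,
      Matrix.smul_mulVec, Matrix.one_mulVec, dotProduct_smul, ← Matrix.mulVec_mulVec,
      Matrix.dotProduct_mulVec, Matrix.vecMul_transpose, smul_eq_mul, sub_nonneg,
      Matrix.trace_mul_comm, Matrix.trace, Finset.sum_mul]
    refine Finset.sum_le_sum fun i _ => ?_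
    have h := Finset.sum_mul_sq_le_sq_mul_sq Finset.univ (B i) x
    simpa only [Matrix.mulVec, dotProduct, ← pow_two, Matrix.diag, Matrix.mul_apply,
      Matrix.transpose_apply] using h

/-- A positive definite matrix dominates every symmetric matrix up to a factor. -/
theorem exists_smul_sub_posSemidef {S M : Matrix (Fin n) (Fin n) ℝ} (hS : S.PosDef)
    (hM : M.IsHermitian) : ∃ γ : ℝ, 0 < γ ∧ (γ • S - M).PosSemidef := by
  -- the quotient of the two quadratic forms is bounded on the unit sphere
  have hq : ∀ N : Matrix (Fin n) (Fin n) ℝ, Continuous fun x : Fin n → ℝ => x ⬝ᵥ (N *ᵥ x) :=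
    fun N => by fun_prop
  have hSx : ∀ x : Fin n → ℝ, x ≠ 0 → 0 < x ⬝ᵥ (S *ᵥ x) := (posDef_iff.1 hS).2
  have hcont : ContinuousOn (fun x : Fin n → ℝ => (x ⬝ᵥ (M *ᵥ x)) / (x ⬝ᵥ (S *ᵥ x)))
      (Metric.sphere 0 1) :=
    (hq M).continuousOn.div (hq S).continuousOn fun x hx =>
      (hSx x (ne_zero_of_mem_unit_sphere (⟨x, hx⟩ : Metric.sphere (0 : Fin n → ℝ) 1))).ne'
  obtain ⟨γ, hγ⟩ := (isCompact_sphere (0 : Fin n → ℝ) 1).bddAbove_image hcont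
  refine ⟨max γ 1, by positivity, posSemidef_iff.2
    ⟨(hS.isHermitian.smul (IsSelfAdjoint.all _)).sub hM, fun x => ?_⟩⟩
  rw [Matrix.sub_mulVec, dotProduct_sub, Matrix.smul_mulVec, dotProduct_smul, smul_eq_mul,
    sub_nonneg]
  rcases eq_or_ne x 0 with rfl | hx
  · simp
  have hr : 0 < ‖x‖ := norm_pos_iff.2 hx
  have hmem : ‖x‖⁻¹ • x ∈ Metric.sphere (0 : Fin n → ℝ) 1 := by
    simp [norm_smul, hr.ne']
  have h := hγ ⟨_, hmem, rfl⟩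
  simp only [Matrix.mulVec_smul, dotProduct_smul, smul_dotProduct, smul_eq_mul] at h
  rw [mul_div_mul_left _ _ (inv_ne_zero hr.ne'), mul_div_mul_left _ _ (inv_ne_zero hr.ne'),
    div_le_iff₀ (hSx x hx)] at h
  exact h.trans (mul_le_mul_of_nonneg_right (le_max_left _ _) (hSx x hx).le)

/-- A positive definite matrix stays so after subtracting a small positive semidefinite one. -/
theorem eventually_posDef_sub {P : Matrix (Fin n) (Fin n) ℝ} (hP : P.PosDef)
    {M : ℕ → Matrix (Fin n) (Fin n) ℝ} (hM : ∀ k, (M k).PosSemidef)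
    (h0 : Tendsto (fun k => (M k).trace) atTop (𝓝 0)) :
    ∀ᶠ k in atTop, (P - M k).PosDef := by
  obtain ⟨γ, hγ, h⟩ := exists_smul_sub_posSemidef hP
    (Matrix.isHermitian_one (n := Fin n) (α := ℝ))
  filter_upwards [h0.eventually_lt_const (inv_pos.2 hγ)] with k hk
  -- `P - M ≥ (γ⁻¹ - tr M) I` up to positive semidefinite terms
  have h1 : ((γ⁻¹ - (M k).trace) • (1 : Matrix (Fin n) (Fin n) ℝ)).PosDef :=
    Matrix.PosDef.one.smul (sub_pos.2 hk)
  have h2 := (h.smul (inv_nonneg.2 hγ.le)).add (trace_smul_one_sub_posSemidef (hM k))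
  have h3 := h1.add_posSemidef h2
  convert h3 using 1
  rw [smul_sub, smul_smul, inv_mul_cancel₀ hγ.ne', one_smul, sub_smul]
  abel

theorem trace_mul_nonneg {P X : Matrix (Fin n) (Fin n) ℝ} (hP : P.PosSemidef)
    (hX : X.PosSemidef) : 0 ≤ (P * X).trace := by
  obtain ⟨B, rfl⟩ := exists_eq_transpose_mul_self hP
  rw [Matrix.mul_assoc, Matrix.trace_mul_comm]
  exact (posSemidef_conj hX B).trace_nonneg

end PosSemidef

/-! ### Completely positive maps and Lyapunov inequalities -/

section Kraus

variable {ι : Type*} [Fintype ι] {n : ℕ}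

/-- The completely positive map `X ↦ ∑ᵢ Fᵢ X Fᵢ'` with the Kraus operators `Fᵢ`. -/
def krausMap (F : ι → Matrix (Fin n) (Fin n) ℝ) :
    Matrix (Fin n) (Fin n) ℝ →ₗ[ℝ] Matrix (Fin n) (Fin n) ℝ where
  toFun X := ∑ i, F i * X * (F i)ᵀ
  map_add' X Y := by simp only [Matrix.mul_add, Matrix.add_mul, Finset.sum_add_distrib]
  map_smul' c X := by
    simp only [Matrix.mul_smul, Matrix.smul_mul, Finset.smul_sum, RingHom.id_apply]

theorem krausMap_apply (F : ι → Matrix (Fin n) (Fin n) ℝ) (X : Matrix (Fin n) (Fin n) ℝ) :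
    krausMap F X = ∑ i, F i * X * (F i)ᵀ := rfl

variable {F : ι → Matrix (Fin n) (Fin n) ℝ}

theorem krausMap_posSemidef {X : Matrix (Fin n) (Fin n) ℝ} (hX : X.PosSemidef) :
    (krausMap F X).PosSemidef :=
  Matrix.posSemidef_sum _ fun _ _ => posSemidef_conj hX _

theorem krausMap_pow_posSemidef {X : Matrix (Fin n) (Fin n) ℝ} (hX : X.PosSemidef) (k : ℕ) :
    ((krausMap F ^ k) X).PosSemidef := by
  induction k with
  | zero => simpa using hX
  | succ k ih => rw [pow_succ', Module.End.mul_apply]; exact krausMap_posSemidef ih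

/-- The map with the transposed Kraus operators is the adjoint for the trace pairing. -/
theorem trace_krausMap_mul (P X : Matrix (Fin n) (Fin n) ℝ) :
    (krausMap (fun i => (F i)ᵀ) P * X).trace = (P * krausMap F X).trace := by
  simp only [krausMap_apply, Matrix.sum_mul, Matrix.mul_sum, Matrix.trace_sum,
    Matrix.transpose_transpose]
  refine Finset.sum_congr rfl fun i _ => ?_
  rw [Matrix.mul_assoc, Matrix.mul_assoc, Matrix.trace_mul_comm]
  simp only [Matrix.mul_assoc]

theorem trace_krausMap_pow_mul (k : ℕ) (P X : Matrix (Fin n) (Fin n) ℝ) :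
    ((krausMap (fun i => (F i)ᵀ) ^ k) P * X).trace = (P * (krausMap F ^ k) X).trace := by
  induction k generalizing X with
  | zero => simp
  | succ k ih =>
    rw [pow_succ', Module.End.mul_apply, trace_krausMap_mul, ih, pow_succ, Module.End.mul_apply]

/-- If `P > 𝒯 P` for a positive map `𝒯`, the iterates of `𝒯` decay geometrically. -/
theorem exists_geometric_bound {P : Matrix (Fin n) (Fin n) ℝ} (hP : P.PosDef)
    (h : (P - krausMap F P).PosDef) :
    ∃ c : ℝ, 0 ≤ c ∧ c < 1 ∧ ∀ M : Matrix (Fin n) (Fin n) ℝ, M.PosSemidef →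
      ∃ γ : ℝ, ∀ k i j, |(krausMap F ^ k) M i j| ≤ γ * c ^ k := by
  obtain ⟨δ, hδ, h1⟩ := exists_smul_sub_posSemidef h hP.isHermitian
  -- `P ≤ δ (P - 𝒯 P)` with `δ ≥ 1` gives `𝒯 P ≤ (1 - 1/δ) P`
  set d := max δ 1 with hd
  have hd0 : 0 < d := lt_of_lt_of_le hδ (le_max_left _ _)
  have h2 : (d • (P - krausMap F P) - P).PosSemidef := by
    have := h1.add (h.posSemidef.smul (sub_nonneg.2 (le_max_left δ 1)))
    convert this using 1
    rw [sub_smul, ← hd]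
    abel
  set c := 1 - d⁻¹ with hc
  have hc0 : 0 ≤ c := sub_nonneg.2 (inv_le_one_of_one_le₀ (le_max_right _ _))
  have hcP : (c • P - krausMap F P).PosSemidef := by
    convert h2.smul (inv_nonneg.2 hd0.le) using 1
    rw [smul_sub, smul_smul, inv_mul_cancel₀ hd0.ne', one_smul, hc, sub_smul, one_smul]
    abel
  refine ⟨c, hc0, sub_lt_self _ (inv_pos.2 hd0), fun M hM => ?_⟩
  obtain ⟨γ, hγ, h3⟩ := exists_smul_sub_posSemidef hP hM.isHermitian
  have key : ∀ k, ((γ * c ^ k) • P - (krausMap F ^ k) M).PosSemidef := by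
    intro k
    induction k with
    | zero => simpa using h3
    | succ k ih =>
      have := (krausMap_posSemidef (F := F) ih).add
        (hcP.smul (mul_nonneg hγ.le (pow_nonneg hc0 k)))
      convert this using 1
      rw [pow_succ' (krausMap F), Module.End.mul_apply, map_sub, map_smul, smul_sub, smul_smul,
        mul_assoc, pow_succ]
      abel
  refine ⟨γ * P.trace, fun k i j =>
    (abs_apply_le_trace (krausMap_pow_posSemidef hM k) i j).trans ?_⟩
  have := (key k).trace_nonneg
  rw [Matrix.trace_sub, Matrix.trace_smul, smul_eq_mul] at this
  linarith

theorem tendsto_trace_krausMap_pow {P : Matrix (Fin n) (Fin n) ℝ} (hP : P.PosDef)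
    (h : (P - krausMap F P).PosDef) {M : Matrix (Fin n) (Fin n) ℝ} (hM : M.PosSemidef) :
    Tendsto (fun k => ((krausMap F ^ k) M).trace) atTop (𝓝 0) := by
  obtain ⟨c, hc0, hc1, hb⟩ := exists_geometric_bound hP h
  obtain ⟨γ, hγ⟩ := hb M hM
  have hg : Tendsto (fun k => γ * c ^ k) atTop (𝓝 0) := by
    simpa using (tendsto_pow_atTop_nhds_zero_of_lt_one hc0 hc1).const_mul γ
  have : Tendsto (fun k => ∑ i, (krausMap F ^ k) M i i) atTop (𝓝 (∑ _i : Fin n, 0)) :=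
    tendsto_finsetSum _ fun i _ => squeeze_zero_norm (fun k => hγ k i i) hg
  rw [Finset.sum_const_zero] at this
  exact this

/-- The Neumann series solves the Lyapunov equation. -/
theorem exists_lyapunov_solution {P : Matrix (Fin n) (Fin n) ℝ} (hP : P.PosDef)
    (h : (P - krausMap F P).PosDef) {Q : Matrix (Fin n) (Fin n) ℝ} (hQ : Q.PosDef) :
    ∃ P' : Matrix (Fin n) (Fin n) ℝ, P'.PosDef ∧ P' = Q + krausMap F P' := by
  obtain ⟨c, hc0, hc1, hb⟩ := exists_geometric_bound hP h
  obtain ⟨γ, hγ⟩ := hb Q hQ.posSemidef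
  have hsum : Summable fun k => (krausMap F ^ k) Q := by
    refine Pi.summable.2 fun i => Pi.summable.2 fun j => ?_
    exact ((summable_geometric_of_lt_one hc0 hc1).mul_left γ).of_norm_bounded fun k => hγ k i j
  have hT : Continuous (krausMap F) := LinearMap.continuous_of_finiteDimensional _
  have heq : ∑' k, (krausMap F ^ k) Q = Q + krausMap F (∑' k, (krausMap F ^ k) Q) := by
    have hmap := (hsum.hasSum.map (krausMap F) hT).tsum_eq
    rw [← hmap, hsum.tsum_eq_zero_add, pow_zero, Module.End.one_apply]
    refine congrArg (Q + ·) (tsum_congr fun k => ?_)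
    rw [pow_succ', Module.End.mul_apply, Function.comp]
  refine ⟨_, ?_, heq⟩
  rw [heq]
  refine hQ.add_posSemidef (krausMap_posSemidef ?_)
  have hclosed : IsClosed {M : Matrix (Fin n) (Fin n) ℝ | M.PosSemidef} := by
    have : {M : Matrix (Fin n) (Fin n) ℝ | M.PosSemidef} =
        {M | Mᵀ = M} ∩ ⋂ x : Fin n → ℝ, {M | 0 ≤ x ⬝ᵥ (M *ᵥ x)} := by
      ext M
      simp [posSemidef_iff, Matrix.IsHermitian, Matrix.conjTranspose_eq_transpose_of_trivial]
    rw [this]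
    refine (isClosed_eq (by fun_prop) (by fun_prop)).inter (isClosed_iInter fun x => ?_)
    exact isClosed_le (by fun_prop) (by fun_prop)
  exact hclosed.mem_of_tendsto hsum.hasSum (Eventually.of_forall fun s =>
    Matrix.posSemidef_sum _ fun k _ => krausMap_pow_posSemidef hQ.posSemidef k)

/-- If the iterates of a positive map on the identity decay, a partial sum `P` of the Neumann
series of the identity satisfies `P - 𝒯 P = I - 𝒯ᵏ I > 0`. -/
theorem exists_posDef_sub_krausMap
    (h : Tendsto (fun k => ((krausMap F ^ k) 1).trace) atTop (𝓝 0)) :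
    ∃ P : Matrix (Fin n) (Fin n) ℝ, P.PosDef ∧ (P - krausMap F P).PosDef := by
  have hpsd : ∀ k, ((krausMap F ^ k) 1).PosSemidef := krausMap_pow_posSemidef .one
  obtain ⟨k, hk, hk1⟩ := ((eventually_posDef_sub .one hpsd h).and (eventually_ge_atTop 1)).exists
  refine ⟨∑ l ∈ Finset.range k, (krausMap F ^ l) 1, ?_, ?_⟩
  · obtain ⟨k, rfl⟩ := Nat.exists_eq_add_of_le' hk1
    rw [Finset.sum_range_succ']
    exact .posSemidef_add (Matrix.posSemidef_sum _ fun l _ => hpsd _) (by simpa using .one)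
  · convert hk using 1
    rw [map_sum, ← Finset.sum_sub_distrib]
    have := Finset.sum_range_sub' (fun l => (krausMap F ^ l) 1) k
    rw [pow_zero, Module.End.one_apply] at this
    rw [← this]
    refine Finset.sum_congr rfl fun l _ => ?_
    rw [pow_succ', Module.End.mul_apply]

end Kraus

/-! ### The noise and its past -/

section Past

variable {Ω : Type*} {D : ℕ} {ω : ℕ → Ω → Fin (D + 1) → ℝ}

theorem past_mono : Monotone (past ω) := fun _ _ h =>
  biSup_mono fun _ hi => Finset.mem_range.2 ((Finset.mem_range.1 hi).trans_le h)

theorem measurable_noise (t : ℕ) : Measurable[past ω (t + 1)] (ω t) :=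
  Measurable.of_comap_le
    (le_iSup₂ (f := fun s (_ : s ∈ Finset.range (t + 1)) =>
      MeasurableSpace.comap (ω s) inferInstance) t (Finset.self_mem_range_succ t))

end Past

section Probability

variable {Ω : Type*} [MeasurableSpace Ω] {μ : Measure Ω} {D : ℕ}
  {σ : Fin (D + 1) → ℝ} {ω : ℕ → Ω → Fin (D + 1) → ℝ}

section Noise

theorem IsNoise.past_le (hω : IsNoise μ σ ω) (t : ℕ) : past ω t ≤ ‹MeasurableSpace Ω› :=
  iSup₂_le fun s _ => (hω.measurable s).comap_le

/-- The noise at time `t` is independent of everything determined by the earlier noise. -/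
theorem IsNoise.indepFun_past (hω : IsNoise μ σ ω) {t : ℕ} {φ : (Fin (D + 1) → ℝ) → ℝ}
    (hφ : Measurable φ) {f : Ω → ℝ} (hf : Measurable[past ω t] f) :
    IndepFun (fun p => φ (ω t p)) f μ := by
  have hind := (iIndepFun_iff_iIndep _ _ _).1 hω.indep
  have h := indep_iSup_of_disjoint (fun s => (hω.measurable s).comap_le) hind
    (S := {t}) (T := ↑(Finset.range t)) (by simp)
  rw [IndepFun_iff_Indep]
  refine indep_of_indep_of_le_right (indep_of_indep_of_le_left h ?_) ?_
  · rw [iSup_singleton]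
    exact (hφ.comp (comap_measurable (ω t))).comap_le
  · exact hf.comap_le

theorem IsNoise.memLp_mul (hω : IsNoise μ σ ω) {t : ℕ} (τ : Fin (D + 1)) {f : Ω → ℝ}
    (hf : Measurable[past ω t] f) (hf2 : MemLp f 2 μ) :
    MemLp (fun p => ω t p τ * f p) 2 μ := by
  have hω2 := hω.memLp t τ
  refine (memLp_two_iff_integrable_sq
    (hω2.aestronglyMeasurable.mul hf2.aestronglyMeasurable)).2 ?_
  have hind : IndepFun (fun p => ω t p τ ^ 2) (fun p => f p ^ 2) μ :=
    hω.indepFun_past (φ := fun y => y τ ^ 2) (by fun_prop) (hf.pow_const 2)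
  have h := hind.integrable_mul hω2.integrable_sq hf2.integrable_sq
  exact h.congr (Eventually.of_forall fun p => by simp [mul_pow])

theorem IsNoise.integral_mul_eq_zero (hω : IsNoise μ σ ω) {t : ℕ} (τ : Fin (D + 1))
    {f g : Ω → ℝ} (hf : Measurable[past ω t] f) (hg : Measurable[past ω t] g) :
    ∫ p, f p * (ω t p τ * g p) ∂μ = 0 := by
  have hind : IndepFun (fun p => ω t p τ) (fun p => f p * g p) μ :=
    hω.indepFun_past (φ := fun y => y τ) (by fun_prop) (hf.mul hg)
  have hle := hω.past_le t
  have h := hind.integral_fun_mul_eq_mul_integral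
    (hω.memLp t τ).aestronglyMeasurable ((hf.mul hg).mono hle le_rfl).aestronglyMeasurable
  rw [hω.mean t τ, zero_mul] at h
  rw [← h]
  exact integral_congr_ae (Eventually.of_forall fun p => by ring)

theorem IsNoise.integral_mul_mul (hω : IsNoise μ σ ω) {t : ℕ} (τ ρ : Fin (D + 1))
    {f g : Ω → ℝ} (hf : Measurable[past ω t] f) (hg : Measurable[past ω t] g) :
    ∫ p, (ω t p τ * f p) * (ω t p ρ * g p) ∂μ =
      (if τ = ρ then σ τ ^ 2 else 0) * ∫ p, f p * g p ∂μ := by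
  have hind : IndepFun (fun p => ω t p τ * ω t p ρ) (fun p => f p * g p) μ :=
    hω.indepFun_past (φ := fun y => y τ * y ρ) (by fun_prop) (hf.mul hg)
  have hle := hω.past_le t
  have h := hind.integral_fun_mul_eq_mul_integral
    ((hω.memLp t τ).aestronglyMeasurable.mul (hω.memLp t ρ).aestronglyMeasurable)
    ((hf.mul hg).mono hle le_rfl).aestronglyMeasurable
  rw [hω.covariance t τ ρ] at h
  rw [← h]
  exact integral_congr_ae (Eventually.of_forall fun p => by ring)

end Noise

/-! ### Second moments -/

section PastSq

variable {k l : ℕ} {t : ℕ}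

/-- The random vector `X` is `ℱ_{t-1}`-measurable and square integrable. -/
structure IsPastSq (μ : Measure Ω) (ω : ℕ → Ω → Fin (D + 1) → ℝ) (t : ℕ)
    (X : Ω → Fin k → ℝ) : Prop where
  measurable : Measurable[past ω t] X
  memLp : ∀ i, MemLp (fun p => X p i) 2 μ

theorem IsPastSq.measurable_apply {X : Ω → Fin k → ℝ} (hX : IsPastSq μ ω t X) (i : Fin k) :
    Measurable[past ω t] fun p => X p i :=
  (measurable_pi_apply i).comp hX.measurable

theorem IsPastSq.mono {X : Ω → Fin k → ℝ} {s : ℕ} (hX : IsPastSq μ ω s X) (h : s ≤ t) :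
    IsPastSq μ ω t X :=
  ⟨hX.measurable.mono (past_mono h) le_rfl, hX.memLp⟩

theorem isPastSq_const [IsFiniteMeasure μ] (a : Fin k → ℝ) : IsPastSq μ ω t fun _ => a :=
  ⟨measurable_const, fun _ => memLp_const _⟩

theorem IsPastSq.add {X Y : Ω → Fin k → ℝ} (hX : IsPastSq μ ω t X) (hY : IsPastSq μ ω t Y) :
    IsPastSq μ ω t fun p => X p + Y p :=
  ⟨hX.measurable.add hY.measurable, fun i => (hX.memLp i).add (hY.memLp i)⟩

theorem isPastSq_sum {ι : Type*} (s : Finset ι) {X : ι → Ω → Fin k → ℝ}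
    (hX : ∀ i ∈ s, IsPastSq μ ω t (X i)) : IsPastSq μ ω t fun p => ∑ i ∈ s, X i p := by
  refine ⟨Finset.measurable_fun_sum s fun i hi => (hX i hi).measurable, fun j => ?_⟩
  simp only [Finset.sum_apply]
  exact memLp_finsetSum s fun i hi => (hX i hi).memLp j

theorem IsPastSq.mulVec {X : Ω → Fin k → ℝ} (hX : IsPastSq μ ω t X)
    (M : Matrix (Fin l) (Fin k) ℝ) : IsPastSq μ ω t fun p => M *ᵥ X p := by
  have hM : Measurable fun x : Fin k → ℝ => M *ᵥ x :=
    (by fun_prop : Continuous fun x : Fin k → ℝ => M *ᵥ x).measurable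
  refine ⟨hM.comp hX.measurable, fun i => ?_⟩
  simp only [Matrix.mulVec, dotProduct]
  exact memLp_finsetSum _ fun j _ => (hX.memLp j).const_mul _

theorem IsPastSq.noise_smul {X : Ω → Fin k → ℝ} (hω : IsNoise μ σ ω) (hX : IsPastSq μ ω t X)
    (τ : Fin (D + 1)) : IsPastSq μ ω (t + 1) fun p => ω t p τ • X p := by
  refine ⟨?_, fun i => hω.memLp_mul τ (hX.measurable_apply i) (hX.memLp i)⟩
  exact ((measurable_pi_apply τ).comp (measurable_noise t)).smul
    (hX.mono (Nat.le_succ t)).measurable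

/-- The matrix of mixed second moments `E (X Y')`. -/
def crossMoment (μ : Measure Ω) (X : Ω → Fin k → ℝ) (Y : Ω → Fin l → ℝ) :
    Matrix (Fin k) (Fin l) ℝ :=
  Matrix.of fun i j => ∫ p, X p i * Y p j ∂μ

theorem crossMoment_apply (X : Ω → Fin k → ℝ) (Y : Ω → Fin l → ℝ) (i : Fin k) (j : Fin l) :
    crossMoment μ X Y i j = ∫ p, X p i * Y p j ∂μ := rfl

theorem crossMoment_transpose (X : Ω → Fin k → ℝ) (Y : Ω → Fin l → ℝ) :
    (crossMoment μ X Y)ᵀ = crossMoment μ Y X := by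
  ext i j
  simp only [Matrix.transpose_apply, crossMoment_apply, mul_comm]

theorem crossMoment_const [IsProbabilityMeasure μ] (a : Fin k → ℝ) :
    crossMoment μ (fun _ => a) (fun _ => a) = Matrix.vecMulVec a a := by
  ext i j
  simp [crossMoment_apply, Matrix.vecMulVec_apply]

theorem crossMoment_add_left {X X' : Ω → Fin k → ℝ} {Y : Ω → Fin l → ℝ}
    (hX : IsPastSq μ ω t X) (hX' : IsPastSq μ ω t X') (hY : IsPastSq μ ω t Y) :
    crossMoment μ (fun p => X p + X' p) Y = crossMoment μ X Y + crossMoment μ X' Y := by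
  ext i j
  simp only [Matrix.add_apply, crossMoment_apply, Pi.add_apply, add_mul]
  exact integral_add ((hX.memLp i).integrable_mul (hY.memLp j))
    ((hX'.memLp i).integrable_mul (hY.memLp j))

theorem crossMoment_add_right {X : Ω → Fin k → ℝ} {Y Y' : Ω → Fin l → ℝ}
    (hX : IsPastSq μ ω t X) (hY : IsPastSq μ ω t Y) (hY' : IsPastSq μ ω t Y') :
    crossMoment μ X (fun p => Y p + Y' p) = crossMoment μ X Y + crossMoment μ X Y' := by
  rw [← crossMoment_transpose, crossMoment_add_left hY hY' hX, Matrix.transpose_add,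
    crossMoment_transpose, crossMoment_transpose]

theorem crossMoment_sum_left {ι : Type*} (s : Finset ι) {X : ι → Ω → Fin k → ℝ}
    {Y : Ω → Fin l → ℝ} (hX : ∀ i ∈ s, IsPastSq μ ω t (X i)) (hY : IsPastSq μ ω t Y) :
    crossMoment μ (fun p => ∑ i ∈ s, X i p) Y = ∑ i ∈ s, crossMoment μ (X i) Y := by
  ext i j
  simp only [Matrix.sum_apply, crossMoment_apply, Finset.sum_apply, Finset.sum_mul]
  exact integral_finsetSum s fun a ha => ((hX a ha).memLp i).integrable_mul (hY.memLp j)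

theorem crossMoment_sum_right {ι : Type*} (s : Finset ι) {X : Ω → Fin k → ℝ}
    {Y : ι → Ω → Fin l → ℝ} (hX : IsPastSq μ ω t X) (hY : ∀ i ∈ s, IsPastSq μ ω t (Y i)) :
    crossMoment μ X (fun p => ∑ i ∈ s, Y i p) = ∑ i ∈ s, crossMoment μ X (Y i) := by
  rw [← crossMoment_transpose, crossMoment_sum_left s hY hX, Matrix.transpose_sum]
  simp only [crossMoment_transpose]

theorem crossMoment_mulVec_left {k' : ℕ} {X : Ω → Fin k → ℝ} {Y : Ω → Fin l → ℝ}
    (hX : IsPastSq μ ω t X) (hY : IsPastSq μ ω t Y) (M : Matrix (Fin k') (Fin k) ℝ) :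
    crossMoment μ (fun p => M *ᵥ X p) Y = M * crossMoment μ X Y := by
  ext i j
  simp only [crossMoment_apply, Matrix.mul_apply, Matrix.mulVec, dotProduct, Finset.sum_mul,
    mul_assoc]
  have hint : ∀ a, Integrable (fun p => X p a * Y p j) μ := fun a =>
    (hX.memLp a).integrable_mul (hY.memLp j)
  have h := integral_finsetSum Finset.univ fun a _ => (hint a).const_mul (M i a)
  simpa only [integral_const_mul] using h

theorem crossMoment_mulVec_right {l' : ℕ} {X : Ω → Fin k → ℝ} {Y : Ω → Fin l → ℝ}
    (hX : IsPastSq μ ω t X) (hY : IsPastSq μ ω t Y) (M : Matrix (Fin l') (Fin l) ℝ) :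
    crossMoment μ X (fun p => M *ᵥ Y p) = crossMoment μ X Y * Mᵀ := by
  rw [← crossMoment_transpose, crossMoment_mulVec_left hY hX, Matrix.transpose_mul,
    crossMoment_transpose]

theorem dotProduct_crossMoment_mulVec {X : Ω → Fin k → ℝ} (hX : IsPastSq μ ω t X)
    (a : Fin k → ℝ) :
    a ⬝ᵥ (crossMoment μ X X *ᵥ a) = ∫ p, (a ⬝ᵥ X p) ^ 2 ∂μ := by
  have hint : ∀ i j, Integrable (fun p => X p i * X p j) μ := fun i j =>
    (hX.memLp i).integrable_mul (hX.memLp j)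
  have h : ∀ p, (a ⬝ᵥ X p) ^ 2 = ∑ i, ∑ j, a i * (X p i * X p j) * a j := by
    intro p
    rw [pow_two, dotProduct, Finset.sum_mul_sum]
    exact Finset.sum_congr rfl fun i _ => Finset.sum_congr rfl fun j _ => by ring
  have hint' : ∀ i j, Integrable (fun p => a i * (X p i * X p j) * a j) μ := fun i j =>
    ((hint i j).const_mul _).mul_const _
  simp only [h]
  rw [integral_finsetSum _ fun i _ => integrable_finsetSum _ fun j _ => hint' i j]
  refine Finset.sum_congr rfl fun i _ => ?_
  rw [integral_finsetSum _ fun j _ => hint' i j]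
  simp only [integral_mul_const, integral_const_mul]
  simp only [Matrix.mulVec, dotProduct, crossMoment_apply, Finset.mul_sum, mul_assoc]

theorem crossMoment_self_posSemidef {X : Ω → Fin k → ℝ} (hX : IsPastSq μ ω t X) :
    (crossMoment μ X X).PosSemidef := by
  refine Matrix.PosSemidef.of_dotProduct_mulVec_nonneg ?_ fun a => ?_
  · rw [Matrix.IsHermitian, Matrix.conjTranspose_eq_transpose_of_trivial, crossMoment_transpose]
  · rw [star_trivial, dotProduct_crossMoment_mulVec hX]
    exact integral_nonneg fun p => sq_nonneg _

theorem meanSquare_eq_trace {X : Ω → Fin k → ℝ} (hX : IsPastSq μ ω t X) :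
    meanSquare μ X = ENNReal.ofReal (crossMoment μ X X).trace := by
  have hint : ∀ i, Integrable (fun p => X p i * X p i) μ := fun i =>
    (hX.memLp i).integrable_mul (hX.memLp i)
  rw [meanSquare, ← ofReal_integral_eq_lintegral_ofReal]
  · congr 1
    simp only [dotProduct, Matrix.trace, Matrix.diag, crossMoment_apply]
    exact integral_finsetSum _ fun i _ => hint i
  · simp only [dotProduct]
    exact integrable_finsetSum _ fun i _ => hint i
  · exact Eventually.of_forall fun p => Finset.sum_nonneg fun i _ => mul_self_nonneg _

theorem crossMoment_noise_smul_right (hω : IsNoise μ σ ω) {X : Ω → Fin k → ℝ}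
    {Y : Ω → Fin l → ℝ} (hX : IsPastSq μ ω t X) (hY : IsPastSq μ ω t Y) (τ : Fin (D + 1)) :
    crossMoment μ X (fun p => ω t p τ • Y p) = 0 := by
  ext i j
  simpa only [crossMoment_apply, Pi.smul_apply, smul_eq_mul, Matrix.zero_apply] using
    hω.integral_mul_eq_zero τ (hX.measurable_apply i) (hY.measurable_apply j)

theorem crossMoment_noise_smul_smul (hω : IsNoise μ σ ω) {X : Ω → Fin k → ℝ}
    {Y : Ω → Fin l → ℝ} (hX : IsPastSq μ ω t X) (hY : IsPastSq μ ω t Y) (τ ρ : Fin (D + 1)) :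
    crossMoment μ (fun p => ω t p τ • X p) (fun p => ω t p ρ • Y p) =
      if τ = ρ then σ τ ^ 2 • crossMoment μ X Y else 0 := by
  ext i j
  have h := hω.integral_mul_mul τ ρ (hX.measurable_apply i) (hY.measurable_apply j)
  simp only [crossMoment_apply, Pi.smul_apply, smul_eq_mul]
  rw [h]
  split_ifs <;> simp [crossMoment_apply]

/-- Fresh noise contributes to the second moments without interference. -/
theorem crossMoment_add_noise (hω : IsNoise μ σ ω) {Z : Ω → Fin k → ℝ}
    {W : Fin (D + 1) → Ω → Fin k → ℝ} (hZ : IsPastSq μ ω t Z)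
    (hW : ∀ τ, IsPastSq μ ω t (W τ)) :
    crossMoment μ (fun p => Z p + ∑ τ, ω t p τ • W τ p)
        (fun p => Z p + ∑ τ, ω t p τ • W τ p) =
      crossMoment μ Z Z + ∑ τ, σ τ ^ 2 • crossMoment μ (W τ) (W τ) := by
  have hZ' := hZ.mono (Nat.le_succ t)
  have hN : ∀ τ ∈ Finset.univ, IsPastSq μ ω (t + 1) fun p => ω t p τ • W τ p :=
    fun τ _ => (hW τ).noise_smul hω τ
  have hS := isPastSq_sum Finset.univ hN
  have h0 : crossMoment μ Z (fun p => ∑ τ, ω t p τ • W τ p) = 0 := by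
    rw [crossMoment_sum_right _ hZ' hN]
    exact Finset.sum_eq_zero fun τ _ => crossMoment_noise_smul_right hω hZ (hW τ) τ
  have h1 : crossMoment μ (fun p => ∑ τ, ω t p τ • W τ p) Z = 0 := by
    rw [← crossMoment_transpose, h0, Matrix.transpose_zero]
  rw [crossMoment_add_left hZ' hS (hZ'.add hS), crossMoment_add_right hZ' hZ' hS,
    crossMoment_add_right hS hZ' hS, h0, h1,
    crossMoment_sum_left _ hN hS]
  simp only [crossMoment_sum_right _ (hN _ (Finset.mem_univ _)) hN,
    crossMoment_noise_smul_smul hω (hW _) (hW _), Finset.sum_ite_eq, Finset.mem_univ, if_true,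
    add_zero, zero_add]

end PastSq

/-! ### Convergence in mean square -/

section MeanSquare

variable {k l : ℕ}

theorem tendsto_trace_crossMoment {X : ℕ → Ω → Fin k → ℝ} (hX : ∀ t, IsPastSq μ ω t (X t))
    (h : Tendsto (fun t => meanSquare μ (X t)) atTop (𝓝 0)) :
    Tendsto (fun t => (crossMoment μ (X t) (X t)).trace) atTop (𝓝 0) := by
  have h' := (ENNReal.tendsto_toReal ENNReal.zero_ne_top).comp h
  rw [ENNReal.toReal_zero] at h'
  refine h'.congr fun t => ?_
  rw [Function.comp, meanSquare_eq_trace (hX t),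
    ENNReal.toReal_ofReal (crossMoment_self_posSemidef (hX t)).trace_nonneg]

theorem meanSquare_add_le {X Y : Ω → Fin k → ℝ} (hX : Measurable X) :
    meanSquare μ (fun p => X p + Y p) ≤ 2 * (meanSquare μ X + meanSquare μ Y) := by
  have hm : Measurable fun p => ENNReal.ofReal (X p ⬝ᵥ X p) := by
    have : Continuous fun x : Fin k → ℝ => x ⬝ᵥ x := by fun_prop
    exact (this.measurable.comp hX).ennreal_ofReal
  rw [meanSquare, meanSquare, meanSquare, ← lintegral_add_left hm,
    ← lintegral_const_mul' _ _ (by simp)]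
  refine lintegral_mono fun p => ?_
  have h0 : ∀ x : Fin k → ℝ, 0 ≤ x ⬝ᵥ x := fun x => Finset.sum_nonneg fun i _ => mul_self_nonneg _
  rw [← ENNReal.ofReal_add (h0 _) (h0 _), show (2 : ℝ≥0∞) = ENNReal.ofReal 2 by simp,
    ← ENNReal.ofReal_mul (by norm_num)]
  refine ENNReal.ofReal_le_ofReal ?_
  have h := h0 (X p - Y p)
  simp only [add_dotProduct, dotProduct_add, sub_dotProduct, dotProduct_sub] at h ⊢
  linarith [dotProduct_comm (X p) (Y p)]

theorem meanSquare_mulVec_le (M : Matrix (Fin l) (Fin k) ℝ) (X : Ω → Fin k → ℝ) :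
    meanSquare μ (fun p => M *ᵥ X p) ≤ ENNReal.ofReal (M * Mᵀ).trace * meanSquare μ X := by
  rw [meanSquare, meanSquare, ← lintegral_const_mul' _ _ (by simp)]
  refine lintegral_mono fun p => ?_
  have h0 : 0 ≤ (M * Mᵀ).trace := by
    simpa only [Matrix.conjTranspose_eq_transpose_of_trivial] using
      (Matrix.posSemidef_self_mul_conjTranspose M).trace_nonneg
  rw [← ENNReal.ofReal_mul h0]
  refine ENNReal.ofReal_le_ofReal ?_
  rw [Matrix.trace, Finset.sum_mul]
  refine Finset.sum_le_sum fun i _ => ?_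
  simpa only [Matrix.mulVec, dotProduct, ← pow_two, Matrix.diag, Matrix.mul_apply,
      Matrix.transpose_apply] using Finset.sum_mul_sq_le_sq_mul_sq Finset.univ (M i) (X p)

theorem tendsto_meanSquare_add {X Y : ℕ → Ω → Fin k → ℝ} (hX : ∀ t, Measurable (X t))
    (hX0 : Tendsto (fun t => meanSquare μ (X t)) atTop (𝓝 0))
    (hY0 : Tendsto (fun t => meanSquare μ (Y t)) atTop (𝓝 0)) :
    Tendsto (fun t => meanSquare μ fun p => X t p + Y t p) atTop (𝓝 0) := by
  have h : Tendsto (fun t => 2 * (meanSquare μ (X t) + meanSquare μ (Y t))) atTop (𝓝 0) := by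
    simpa using ENNReal.Tendsto.const_mul (hX0.add hY0) (Or.inr ENNReal.ofNat_ne_top)
  exact tendsto_of_tendsto_of_tendsto_of_le_of_le tendsto_const_nhds h (fun _ => zero_le)
    fun t => meanSquare_add_le (hX t)

theorem tendsto_meanSquare_mulVec (M : Matrix (Fin l) (Fin k) ℝ) {X : ℕ → Ω → Fin k → ℝ}
    (hX0 : Tendsto (fun t => meanSquare μ (X t)) atTop (𝓝 0)) :
    Tendsto (fun t => meanSquare μ fun p => M *ᵥ X t p) atTop (𝓝 0) := by
  have h : Tendsto (fun t => ENNReal.ofReal (M * Mᵀ).trace * meanSquare μ (X t)) atTop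
      (𝓝 0) := by
    simpa using ENNReal.Tendsto.const_mul hX0 (Or.inr ENNReal.ofReal_ne_top)
  exact tendsto_of_tendsto_of_tendsto_of_le_of_le tendsto_const_nhds h (fun _ => zero_le)
    fun t => meanSquare_mulVec_le M (X t)

theorem tendsto_meanSquare_sum {ι : Type*} (s : Finset ι) {X : ι → ℕ → Ω → Fin k → ℝ}
    (hX : ∀ i ∈ s, ∀ t, Measurable (X i t))
    (hX0 : ∀ i ∈ s, Tendsto (fun t => meanSquare μ (X i t)) atTop (𝓝 0)) :
    Tendsto (fun t => meanSquare μ fun p => ∑ i ∈ s, X i t p) atTop (𝓝 0) := by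
  classical
  induction s using Finset.induction_on with
  | empty => simp [meanSquare]
  | insert a s ha ih =>
    simp only [Finset.sum_insert ha]
    exact tendsto_meanSquare_add (hX a (Finset.mem_insert_self a s))
      (hX0 a (Finset.mem_insert_self a s))
      (ih (fun i hi => hX i (Finset.mem_insert_of_mem hi))
        fun i hi => hX0 i (Finset.mem_insert_of_mem hi))

end MeanSquare

end Probability

/-! ### The reduced state -/

section Reduction

variable {Ω : Type*} {n m D : ℕ} (A : Matrix (Fin n) (Fin n) ℝ)
  (B C : Fin (D + 1) → Matrix (Fin n) (Fin m) ℝ)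

/-- The weight `∑_{τ > k} A^{D+k-τ} B_τ` of the input `u_{t-1-k}` in the reduced state. The
subtraction in the exponent does not truncate, as `τ ≤ D`. -/
def delayGain (k : ℕ) : Matrix (Fin n) (Fin m) ℝ :=
  ∑ τ : Fin (D + 1), if k < (τ : ℕ) then A ^ (D + k - τ) * B τ else 0

theorem delayGain_self : delayGain A B D = 0 :=
  Finset.sum_eq_zero fun τ _ => if_neg (by omega)

theorem mul_delayGain (k : Fin D) :
    A * delayGain A B k = A ^ D * B k.succ + delayGain A B (k + 1) := by
  have h : A ^ D * B k.succ = ∑ τ : Fin (D + 1), if τ = k.succ then A ^ D * B τ else 0 := by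
    simp
  rw [h, delayGain, delayGain, Matrix.mul_sum, ← Finset.sum_add_distrib]
  refine Finset.sum_congr rfl fun τ _ => ?_
  have hτ : τ = k.succ ↔ (τ : ℕ) = k + 1 := by simp [Fin.ext_iff]
  have := τ.isLt
  rcases lt_trichotomy (τ : ℕ) (k + 1) with h1 | h1 | h1
  · rw [if_neg (by omega), if_neg (by omega), if_neg (by omega), Matrix.mul_zero,
      add_zero]
  · rw [if_pos (by omega), if_pos (by omega), if_neg (by omega), add_zero, ← Matrix.mul_assoc,
      ← pow_succ']
    congr 2
    omega
  · rw [if_pos (by omega), if_neg (by omega), if_pos (by omega), zero_add, ← Matrix.mul_assoc,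
      ← pow_succ']
    congr 2
    omega

theorem reducedInput_eq : reducedInput A B = A ^ D * B 0 + delayGain A B 0 := by
  rw [reducedInput, delayGain, Fin.sum_univ_succ, Fin.sum_univ_succ]
  simp

/-- The reduced state `β_t = A^D x_t + ∑_{k < D} (∑_{τ > k} A^{D+k-τ} B_τ) u_{t-1-k}`, the
prediction of `x_{t+D}` when the noise and the inputs from the time `t` on vanish. -/
def reducedState (x : ℕ → Ω → Fin n → ℝ) (u : ℤ → Ω → Fin m → ℝ) (t : ℕ) (p : Ω) : Fin n → ℝ :=
  A ^ D *ᵥ x t p + ∑ k : Fin D, delayGain A B k *ᵥ u ((t : ℤ) - ((k : ℤ) + 1)) p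

variable {A B C}

/-- In the reduced state the delays remain only in the noise terms. -/
theorem reducedState_succ {x : ℕ → Ω → Fin n → ℝ} {u : ℤ → Ω → Fin m → ℝ}
    {w : Fin (D + 1) → ℝ} {t : ℕ} {p : Ω}
    (h : x (t + 1) p = A *ᵥ x t p + ∑ τ, (B τ + w τ • C τ) *ᵥ u ((t : ℤ) - (τ : ℤ)) p) :
    reducedState A B x u (t + 1) p =
      A *ᵥ reducedState A B x u t p + reducedInput A B *ᵥ u t p +
        ∑ τ, w τ • ((A ^ D * C τ) *ᵥ u ((t : ℤ) - (τ : ℤ)) p) := by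
  -- the two sides differ by a rearrangement of the inputs with their weights
  have hsum : ∑ τ : Fin (D + 1), (A ^ D * B τ) *ᵥ u ((t : ℤ) - (τ : ℤ)) p +
      ∑ k : Fin D, delayGain A B k *ᵥ u (((t + 1 : ℕ) : ℤ) - ((k : ℤ) + 1)) p =
      ∑ k : Fin D, (A * delayGain A B k) *ᵥ u ((t : ℤ) - ((k : ℤ) + 1)) p +
        reducedInput A B *ᵥ u t p := by
    have h1 : ∑ k : Fin D, delayGain A B k *ᵥ u (((t + 1 : ℕ) : ℤ) - ((k : ℤ) + 1)) p =
        delayGain A B 0 *ᵥ u t p +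
          ∑ k : Fin D, delayGain A B (k + 1) *ᵥ u ((t : ℤ) - ((k : ℤ) + 1)) p := by
      have h2 := Fin.sum_univ_succ fun k : Fin (D + 1) =>
        delayGain A B k *ᵥ u ((t : ℤ) - (k : ℤ)) p
      rw [Fin.sum_univ_castSucc] at h2
      simp only [Fin.val_last, delayGain_self, Matrix.zero_mulVec, add_zero, Fin.val_castSucc,
        Fin.val_zero, Fin.val_succ, Nat.cast_zero, sub_zero, Nat.cast_add, Nat.cast_one] at h2
      rw [← h2]
      refine Finset.sum_congr rfl fun k _ => ?_
      congr 2
      push_cast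
      ring
    rw [h1, Fin.sum_univ_succ]
    simp only [mul_delayGain, Matrix.add_mulVec, Finset.sum_add_distrib, reducedInput_eq,
      Fin.val_zero, Fin.val_succ, Nat.cast_zero, sub_zero, Nat.cast_add, Nat.cast_one]
    abel
  have hnoise : ∀ τ, A ^ D *ᵥ ((B τ + w τ • C τ) *ᵥ u ((t : ℤ) - (τ : ℤ)) p) =
      (A ^ D * B τ) *ᵥ u ((t : ℤ) - (τ : ℤ)) p +
        w τ • ((A ^ D * C τ) *ᵥ u ((t : ℤ) - (τ : ℤ)) p) := fun τ => by
    rw [Matrix.mulVec_mulVec, Matrix.mul_add, Matrix.add_mulVec, Matrix.mul_smul,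
      Matrix.smul_mulVec]
  rw [reducedState, reducedState, h, Matrix.mulVec_add, Matrix.mulVec_sum]
  simp only [hnoise, Finset.sum_add_distrib]
  rw [Matrix.mulVec_add, Matrix.mulVec_sum, Matrix.mulVec_mulVec, Matrix.mulVec_mulVec,
    ← pow_succ, ← pow_succ']
  simp only [Matrix.mulVec_mulVec]
  rw [add_assoc (A ^ (D + 1) *ᵥ x t p) _ (reducedInput A B *ᵥ u t p), ← hsum]
  abel

end Reduction

/-! ### Measurability and integrability of closed-loop trajectories -/

section ClosedLoop

variable {Ω : Type*} [MeasurableSpace Ω] {μ : Measure Ω} {n m D : ℕ}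
  {A : Matrix (Fin n) (Fin n) ℝ} {B C : Fin (D + 1) → Matrix (Fin n) (Fin m) ℝ}
  {σ : Fin (D + 1) → ℝ} {ω : ℕ → Ω → Fin (D + 1) → ℝ}
  {K₀ : Matrix (Fin m) (Fin n) ℝ} {K : Fin D → Matrix (Fin m) (Fin m) ℝ}
  {x₀ : Fin n → ℝ} {φ : Fin D → Fin m → ℝ}
  {x : ℕ → Ω → Fin n → ℝ} {u : ℤ → Ω → Fin m → ℝ}

theorem IsClosedLoop.isPastSq [IsFiniteMeasure μ] (hω : IsNoise μ σ ω)
    (h : IsClosedLoop A B C ω K₀ K x₀ φ x u) (t : ℕ) :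
    IsPastSq μ ω t (x t) ∧ IsPastSq μ ω t (u t) ∧
      ∀ k : Fin D, IsPastSq μ ω t (u ((t : ℤ) - ((k : ℤ) + 1))) := by
  have hfb : ∀ t : ℕ, IsPastSq μ ω t (x t) →
      (∀ k : Fin D, IsPastSq μ ω t (u ((t : ℤ) - ((k : ℤ) + 1)))) → IsPastSq μ ω t (u t) := by
    intro t hx hu
    rw [funext (h.feedback t)]
    exact (hx.mulVec K₀).add (isPastSq_sum _ fun k _ => (hu k).mulVec (K k))
  suffices hs : IsPastSq μ ω t (x t) ∧
      ∀ k : Fin D, IsPastSq μ ω t (u ((t : ℤ) - ((k : ℤ) + 1))) from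
    ⟨hs.1, hfb t hs.1 hs.2, hs.2⟩
  induction t with
  | zero =>
    refine ⟨by rw [funext h.init_state]; exact isPastSq_const x₀, fun k => ?_⟩
    rw [show ((0 : ℕ) : ℤ) - ((k : ℤ) + 1) = -((k : ℤ) + 1) by simp, funext (h.init_input k)]
    exact isPastSq_const (φ k)
  | succ t ih =>
    have hu0 := hfb t ih.1 ih.2
    constructor
    · rw [funext (h.dynamics t)]
      refine ((ih.1.mulVec A).mono t.le_succ).add (isPastSq_sum _ fun τ _ => ?_)
      have hτ : IsPastSq μ ω t (u ((t : ℤ) - (τ : ℤ))) := by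
        induction τ using Fin.cases with
        | zero => simpa using hu0
        | succ k => simpa using ih.2 k
      simp only [Matrix.add_mulVec, Matrix.smul_mulVec]
      exact ((hτ.mulVec (B τ)).mono t.le_succ).add ((hτ.mulVec (C τ)).noise_smul hω τ)
    · intro k
      obtain ⟨k, hk⟩ := k
      cases k with
      | zero => simpa using hu0.mono t.le_succ
      | succ j =>
        have := (ih.2 ⟨j, by omega⟩).mono t.le_succ
        convert this using 2
        push_cast
        ring

theorem IsClosedLoop.isPastSq_delay [IsFiniteMeasure μ] (hω : IsNoise μ σ ω)
    (h : IsClosedLoop A B C ω K₀ K x₀ φ x u) (t : ℕ) {k : ℕ} (hk : k ≤ D) :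
    IsPastSq μ ω t (u ((t : ℤ) - k)) := by
  cases k with
  | zero => simpa using (h.isPastSq hω t).2.1
  | succ k => simpa using (h.isPastSq hω t).2.2 ⟨k, hk⟩

theorem IsClosedLoop.isPastSq_reducedState [IsFiniteMeasure μ] (hω : IsNoise μ σ ω)
    (h : IsClosedLoop A B C ω K₀ K x₀ φ x u) (t : ℕ) :
    IsPastSq μ ω t (reducedState A B x u t) :=
  ((h.isPastSq hω t).1.mulVec _).add
    (isPastSq_sum _ fun k _ => ((h.isPastSq hω t).2.2 k).mulVec _)

end ClosedLoop

/-! ### The balance of second moments -/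

section Moments

variable {Ω : Type*} [MeasurableSpace Ω] {μ : Measure Ω} {n m D : ℕ}
  {σ : Fin (D + 1) → ℝ} {ω : ℕ → Ω → Fin (D + 1) → ℝ}

theorem crossMoment_linearCombination {k l r t : ℕ} {X : Ω → Fin k → ℝ} {Y : Ω → Fin l → ℝ}
    (hX : IsPastSq μ ω t X) (hY : IsPastSq μ ω t Y) (M : Matrix (Fin r) (Fin k) ℝ)
    (N : Matrix (Fin r) (Fin l) ℝ) :
    crossMoment μ (fun p => M *ᵥ X p + N *ᵥ Y p) (fun p => M *ᵥ X p + N *ᵥ Y p) =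
      M * crossMoment μ X X * Mᵀ + M * crossMoment μ X Y * Nᵀ +
        (N * crossMoment μ Y X * Mᵀ + N * crossMoment μ Y Y * Nᵀ) := by
  have hM := hX.mulVec M
  have hN := hY.mulVec N
  rw [crossMoment_add_left hM hN (hM.add hN), crossMoment_add_right hM hM hN,
    crossMoment_add_right hN hM hN, crossMoment_mulVec_left hX hM,
    crossMoment_mulVec_right hX hX, crossMoment_mulVec_left hX hN,
    crossMoment_mulVec_right hX hY, crossMoment_mulVec_left hY hM,
    crossMoment_mulVec_right hY hX, crossMoment_mulVec_left hY hN,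
    crossMoment_mulVec_right hY hY]
  simp only [Matrix.mul_assoc]

theorem crossMoment_mulVec_self {k l t : ℕ} {X : Ω → Fin k → ℝ}
    (hX : IsPastSq μ ω t X) (M : Matrix (Fin l) (Fin k) ℝ) :
    crossMoment μ (fun p => M *ᵥ X p) (fun p => M *ᵥ X p) = M * crossMoment μ X X * Mᵀ := by
  rw [crossMoment_mulVec_left hX (hX.mulVec M), crossMoment_mulVec_right hX hX, Matrix.mul_assoc]

/-- The second moments of the state `β_t` together with those of the contributions
`ω_{t+i}^τ H_τ u_{t-1-j}`, `j = τ-1-i < τ`, which the inputs up to the time `t - 1` still make to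
later states through the delayed noise terms. -/
def storedMoment (μ : Measure Ω) (σ : Fin (D + 1) → ℝ)
    (H : Fin (D + 1) → Matrix (Fin n) (Fin m) ℝ) (β : ℕ → Ω → Fin n → ℝ)
    (u : ℤ → Ω → Fin m → ℝ) (t : ℕ) : Matrix (Fin n) (Fin n) ℝ :=
  crossMoment μ (β t) (β t) + ∑ τ : Fin (D + 1), σ τ ^ 2 •
    ∑ j ∈ Finset.range τ, H τ * crossMoment μ (u ((t : ℤ) - 1 - j)) (u ((t : ℤ) - 1 - j)) * (H τ)ᵀ

variable {H : Fin (D + 1) → Matrix (Fin n) (Fin m) ℝ} {β : ℕ → Ω → Fin n → ℝ}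
  {u : ℤ → Ω → Fin m → ℝ}

theorem storedMoment_posSemidef {t : ℕ} (hβ : IsPastSq μ ω t (β t))
    (hu : ∀ k : ℕ, k ≤ D → IsPastSq μ ω t (u ((t : ℤ) - k))) :
    (storedMoment μ σ H β u t).PosSemidef := by
  refine (crossMoment_self_posSemidef hβ).add (Matrix.posSemidef_sum _ fun τ _ =>
    (Matrix.posSemidef_sum _ fun j hj => posSemidef_conj ?_ _).smul (sq_nonneg _))
  have hj' := Finset.mem_range.1 hj
  have := hu (j + 1) (by omega)
  rw [show (t : ℤ) - ((j + 1 : ℕ) : ℤ) = (t : ℤ) - 1 - j by push_cast; ring] at this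
  exact crossMoment_self_posSemidef this

/-- In the balance of the stored moments the delays disappear: over one step an input contributes
as if it entered through all the noise terms at once. -/
theorem storedMoment_succ (hω : IsNoise μ σ ω) {t : ℕ} {Z : Ω → Fin n → ℝ}
    (hZ : IsPastSq μ ω t Z) (hu : ∀ k : ℕ, k ≤ D → IsPastSq μ ω t (u ((t : ℤ) - k)))
    (hβ : ∀ p, β (t + 1) p = Z p + ∑ τ, ω t p τ • (H τ *ᵥ u ((t : ℤ) - (τ : ℤ)) p)) :
    storedMoment μ σ H β u (t + 1) = storedMoment μ σ H β u t - crossMoment μ (β t) (β t) +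
      (crossMoment μ Z Z + ∑ τ, σ τ ^ 2 • (H τ * crossMoment μ (u t) (u t) * (H τ)ᵀ)) := by
  have huτ : ∀ τ : Fin (D + 1), IsPastSq μ ω t (u ((t : ℤ) - (τ : ℤ))) := fun τ =>
    hu τ (by omega)
  have hm := crossMoment_add_noise hω hZ fun τ => (huτ τ).mulVec (H τ)
  rw [← funext hβ] at hm
  simp only [crossMoment_mulVec_self (huτ _)] at hm
  rw [storedMoment, storedMoment, hm]
  -- the sum over the delays telescopes
  have htel : ∀ τ : Fin (D + 1),
      H τ * crossMoment μ (u ((t : ℤ) - (τ : ℤ))) (u ((t : ℤ) - (τ : ℤ))) * (H τ)ᵀ +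
        ∑ j ∈ Finset.range τ, H τ * crossMoment μ (u (((t + 1 : ℕ) : ℤ) - 1 - j))
          (u (((t + 1 : ℕ) : ℤ) - 1 - j)) * (H τ)ᵀ =
      H τ * crossMoment μ (u t) (u t) * (H τ)ᵀ +
        ∑ j ∈ Finset.range τ, H τ * crossMoment μ (u ((t : ℤ) - 1 - j))
          (u ((t : ℤ) - 1 - j)) * (H τ)ᵀ := by
    intro τ
    have h := (Finset.sum_range_succ (fun j : ℕ =>
      H τ * crossMoment μ (u ((t : ℤ) - j)) (u ((t : ℤ) - j)) * (H τ)ᵀ) τ).symm.trans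
      (Finset.sum_range_succ' _ _)
    simp only [Nat.cast_zero, sub_zero] at h
    rw [add_comm, add_comm (H τ * crossMoment μ (u t) (u t) * (H τ)ᵀ)]
    convert h using 3 <;> (push_cast; ring_nf)
  have hsum : ∑ τ, σ τ ^ 2 •
        (H τ * crossMoment μ (u ((t : ℤ) - (τ : ℤ))) (u ((t : ℤ) - (τ : ℤ))) * (H τ)ᵀ) +
      ∑ τ : Fin (D + 1), σ τ ^ 2 • ∑ j ∈ Finset.range τ,
        H τ * crossMoment μ (u (((t + 1 : ℕ) : ℤ) - 1 - j))
          (u (((t + 1 : ℕ) : ℤ) - 1 - j)) * (H τ)ᵀ =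
      ∑ τ, σ τ ^ 2 • (H τ * crossMoment μ (u t) (u t) * (H τ)ᵀ) +
      ∑ τ : Fin (D + 1), σ τ ^ 2 • ∑ j ∈ Finset.range τ,
        H τ * crossMoment μ (u ((t : ℤ) - 1 - j)) (u ((t : ℤ) - 1 - j)) * (H τ)ᵀ := by
    rw [← Finset.sum_add_distrib, ← Finset.sum_add_distrib]
    exact Finset.sum_congr rfl fun τ _ => by rw [← smul_add, ← smul_add, htel]
  rw [add_assoc, hsum]
  abel

end Moments

/-! ### The second-moment map of the delay-free closed loop -/

section ClosedLoopKraus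

variable {n m D : ℕ} (A : Matrix (Fin n) (Fin n) ℝ) (L : Matrix (Fin n) (Fin m) ℝ)
  (C : Fin (D + 1) → Matrix (Fin n) (Fin m) ℝ) (σ : Fin (D + 1) → ℝ)
  (K : Matrix (Fin m) (Fin n) ℝ)

/-- The Kraus operators `A + L K` and `σ_τ A^D C_τ K`, `0 ≤ τ ≤ D`, of the second-moment dynamics
of the delay-free closed loop. -/
def closedLoopKraus : Option (Fin (D + 1)) → Matrix (Fin n) (Fin n) ℝ
  | none => A + L * K
  | some τ => σ τ • (A ^ D * C τ * K)

theorem krausMap_closedLoopKraus (X : Matrix (Fin n) (Fin n) ℝ) :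
    krausMap (closedLoopKraus A L C σ K) X = (A + L * K) * X * (A + L * K)ᵀ +
      ∑ τ, σ τ ^ 2 • (A ^ D * C τ * (K * X * Kᵀ) * (A ^ D * C τ)ᵀ) := by
  rw [krausMap_apply, Fintype.sum_option]
  refine congrArg₂ _ rfl (Finset.sum_congr rfl fun τ _ => ?_)
  simp only [closedLoopKraus, Matrix.transpose_smul, Matrix.smul_mul, Matrix.mul_smul, smul_smul,
    ← pow_two, Matrix.transpose_mul, Matrix.mul_assoc]

theorem lyapunovMap_eq_krausMap (P : Matrix (Fin n) (Fin n) ℝ) :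
    lyapunovMap A L C σ K P = krausMap (fun i => (closedLoopKraus A L C σ K i)ᵀ) P := by
  rw [krausMap_apply, Fintype.sum_option, lyapunovMap]
  refine congrArg₂ _ (by rw [Matrix.transpose_transpose]; rfl)
    (Finset.sum_congr rfl fun τ _ => ?_)
  simp only [closedLoopKraus, Matrix.transpose_transpose, Matrix.transpose_smul, Matrix.smul_mul,
    Matrix.mul_smul, smul_smul, ← pow_two, Matrix.transpose_mul, Matrix.transpose_pow,
    Matrix.mul_assoc]

variable {A L C σ}

/-- From a strict inequality for a joint second-moment matrix with the blocks `S`, `G'`, `G`, `U`,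
the gain `K = G S⁻¹` of the best linear prediction of the input by the state solves the
Lyapunov inequality for `S`: the prediction error has the covariance `U - K S K' ≥ 0`. -/
theorem exists_posDef_sub_of_joint {S : Matrix (Fin n) (Fin n) ℝ} {G : Matrix (Fin m) (Fin n) ℝ}
    {U : Matrix (Fin m) (Fin m) ℝ} (hS : S.PosDef)
    (hU : ∀ K : Matrix (Fin m) (Fin n) ℝ,
      (U - K * Gᵀ - G * Kᵀ + K * S * Kᵀ).PosSemidef)
    (h : (S - (A * S * Aᵀ + A * Gᵀ * Lᵀ + (L * G * Aᵀ + L * U * Lᵀ) +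
      ∑ τ, σ τ ^ 2 • (A ^ D * C τ * U * (A ^ D * C τ)ᵀ))).PosDef) :
    ∃ K : Matrix (Fin m) (Fin n) ℝ, (S - krausMap (closedLoopKraus A L C σ K) S).PosDef := by
  have hdet : IsUnit S.det := (Matrix.isUnit_iff_isUnit_det _).1 hS.isUnit
  have hsym : Sᵀ = S := by
    simpa only [Matrix.IsHermitian, Matrix.conjTranspose_eq_transpose_of_trivial] using
      hS.isHermitian
  obtain ⟨K, hK⟩ : ∃ K : Matrix (Fin m) (Fin n) ℝ, K * S = G :=
    ⟨G * S⁻¹, by rw [Matrix.mul_assoc, Matrix.nonsing_inv_mul _ hdet, Matrix.mul_one]⟩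
  have hKt : S * Kᵀ = Gᵀ := by rw [← hK, Matrix.transpose_mul, hsym]
  have hR : (U - K * S * Kᵀ).PosSemidef := by
    have := hU K
    rwa [← hKt, ← hK, ← Matrix.mul_assoc, sub_add_cancel] at this
  refine ⟨K, ?_⟩
  have h2 := h.add_posSemidef ((posSemidef_conj hR L).add
    (Matrix.posSemidef_sum Finset.univ fun τ _ =>
      (posSemidef_conj hR (A ^ D * C τ)).smul (sq_nonneg (σ τ))))
  convert h2 using 1
  rw [krausMap_closedLoopKraus, ← hKt, ← hK]
  simp only [Matrix.mul_sub, Matrix.sub_mul, smul_sub, Finset.sum_sub_distrib,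
    Matrix.transpose_add, Matrix.transpose_mul, Matrix.mul_add, Matrix.add_mul, Matrix.mul_assoc]
  abel

end ClosedLoopKraus

/-! ### The delay-free system and the reduction -/

section DelayFreeState

variable {Ω : Type*} {n m D : ℕ} {A : Matrix (Fin n) (Fin n) ℝ} {L : Matrix (Fin n) (Fin m) ℝ}
  {C : Fin (D + 1) → Matrix (Fin n) (Fin m) ℝ} {ω : ℕ → Ω → Fin (D + 1) → ℝ}

theorem delayFreeState_succ (K : Matrix (Fin m) (Fin n) ℝ) (β₀ : Fin n → ℝ) (t : ℕ) (p : Ω) :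
    delayFreeState A L C ω K β₀ (t + 1) p = (A + L * K) *ᵥ delayFreeState A L C ω K β₀ t p +
      ∑ τ, ω t p τ • ((A ^ D * C τ) *ᵥ (K *ᵥ delayFreeState A L C ω K β₀ t p)) := by
  rw [Matrix.add_mulVec, ← Matrix.mulVec_mulVec]
  rfl

end DelayFreeState

section Stabilization

variable {Ω : Type*} [MeasurableSpace Ω] {μ : Measure Ω} [IsProbabilityMeasure μ] {n m D : ℕ}
  {A : Matrix (Fin n) (Fin n) ℝ} {L : Matrix (Fin n) (Fin m) ℝ}
  {B C : Fin (D + 1) → Matrix (Fin n) (Fin m) ℝ}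
  {σ : Fin (D + 1) → ℝ} {ω : ℕ → Ω → Fin (D + 1) → ℝ}

theorem isPastSq_delayFreeState (hω : IsNoise μ σ ω) (K : Matrix (Fin m) (Fin n) ℝ)
    (β₀ : Fin n → ℝ) (t : ℕ) : IsPastSq μ ω t (delayFreeState A L C ω K β₀ t) := by
  induction t with
  | zero => exact isPastSq_const β₀
  | succ t ih =>
    rw [funext (delayFreeState_succ K β₀ t)]
    exact ((ih.mulVec _).mono t.le_succ).add
      (isPastSq_sum _ fun τ _ => ((ih.mulVec K).mulVec _).noise_smul hω τ)

theorem crossMoment_delayFreeState (hω : IsNoise μ σ ω) (K : Matrix (Fin m) (Fin n) ℝ)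
    (β₀ : Fin n → ℝ) (t : ℕ) :
    crossMoment μ (delayFreeState A L C ω K β₀ t) (delayFreeState A L C ω K β₀ t) =
      (krausMap (closedLoopKraus A L C σ K) ^ t) (Matrix.vecMulVec β₀ β₀) := by
  induction t with
  | zero => exact crossMoment_const β₀
  | succ t ih =>
    have hβ := isPastSq_delayFreeState (A := A) (L := L) (C := C) hω K β₀ t
    rw [funext (delayFreeState_succ K β₀ t),
      crossMoment_add_noise hω (hβ.mulVec _) fun τ => (hβ.mulVec K).mulVec _,
      pow_succ', Module.End.mul_apply, ← ih, krausMap_closedLoopKraus,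
      crossMoment_mulVec_self hβ]
    simp only [crossMoment_mulVec_self (hβ.mulVec K), crossMoment_mulVec_self hβ]

theorem tendsto_meanSquare_delayFreeState_iff (hω : IsNoise μ σ ω)
    (K : Matrix (Fin m) (Fin n) ℝ) (β₀ : Fin n → ℝ) :
    Tendsto (fun t => meanSquare μ (delayFreeState A L C ω K β₀ t)) atTop (𝓝 0) ↔
      Tendsto (fun t => ((krausMap (closedLoopKraus A L C σ K) ^ t)
        (Matrix.vecMulVec β₀ β₀)).trace) atTop (𝓝 0) := by
  have hβ := isPastSq_delayFreeState (A := A) (L := L) (C := C) hω K β₀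
  simp only [← crossMoment_delayFreeState hω]
  refine ⟨tendsto_trace_crossMoment hβ, fun h => ?_⟩
  simp only [meanSquare_eq_trace (hβ _)]
  simpa using ENNReal.tendsto_ofReal h

theorem vecMulVec_self_posSemidef (a : Fin n → ℝ) : (Matrix.vecMulVec a a).PosSemidef := by
  simpa using Matrix.posSemidef_vecMulVec_self_star a

/-- The Lyapunov inequality for the second moments of the delay-free closed loop stabilizes it. -/
theorem isDelayFreeStabilizable_of_posDef_sub (hω : IsNoise μ σ ω)
    {K : Matrix (Fin m) (Fin n) ℝ} {S : Matrix (Fin n) (Fin n) ℝ} (hS : S.PosDef)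
    (h : (S - krausMap (closedLoopKraus A L C σ K) S).PosDef) :
    IsDelayFreeStabilizable μ A L C ω :=
  ⟨K, fun β₀ => (tendsto_meanSquare_delayFreeState_iff hω K β₀).2
    (tendsto_trace_krausMap_pow hS h (vecMulVec_self_posSemidef β₀))⟩

theorem sum_vecMulVec_single :
    ∑ i : Fin n, Matrix.vecMulVec (Pi.single i (1 : ℝ)) (Pi.single i 1) = 1 := by
  ext a b
  simp [Matrix.sum_apply, Matrix.vecMulVec_apply, Matrix.one_apply, Pi.single_apply]

theorem IsDelayFreeStabilizable.exists_posDef_sub (hω : IsNoise μ σ ω)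
    (h : IsDelayFreeStabilizable μ A L C ω) :
    ∃ (K : Matrix (Fin m) (Fin n) ℝ) (P : Matrix (Fin n) (Fin n) ℝ), P.PosDef ∧
      (P - lyapunovMap A L C σ K P).PosDef := by
  obtain ⟨K, hK⟩ := h
  have h1 : Tendsto (fun t => ((krausMap (closedLoopKraus A L C σ K) ^ t) 1).trace) atTop
      (𝓝 0) := by
    have := tendsto_finsetSum Finset.univ fun i _ =>
      (tendsto_meanSquare_delayFreeState_iff hω K (Pi.single i 1)).1 (hK (Pi.single i 1))
    simpa only [← Matrix.trace_sum, ← map_sum, sum_vecMulVec_single, Finset.sum_const_zero]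
      using this
  refine ⟨K, ?_⟩
  simp only [lyapunovMap_eq_krausMap]
  refine exists_posDef_sub_krausMap (h1.congr fun t => ?_)
  have := trace_krausMap_pow_mul (F := closedLoopKraus A L C σ K) t 1 1
  rw [Matrix.mul_one, Matrix.one_mul] at this
  exact this.symm

theorem tendsto_shift {f : ℤ → ℝ≥0∞} (h : Tendsto (fun t : ℕ => f t) atTop (𝓝 0)) (k : ℕ) :
    Tendsto (fun t : ℕ => f ((t : ℤ) - k)) atTop (𝓝 0) := by
  refine (tendsto_add_atTop_iff_nat k).1 (h.congr fun t => ?_)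
  congr 1
  push_cast
  ring

/-- The feedback of the delay-free system, applied to the reduced state, stabilizes the delayed
system: `tr (P R_t)`, with `R_t` the stored moments, decreases by at least a fixed multiple of
`E (β_t' β_t)` in each step. -/
theorem isStabilizable_of_posDef_sub (hA : IsUnit A) (hω : IsNoise μ σ ω)
    {K : Matrix (Fin m) (Fin n) ℝ} {P : Matrix (Fin n) (Fin n) ℝ} (hP : P.PosDef)
    (h : (P - lyapunovMap A (reducedInput A B) C σ K P).PosDef) :
    IsStabilizable μ A B C ω := by
  refine ⟨K * A ^ D, fun k => K * delayGain A B k, fun x₀ φ x u hcl => ?_⟩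
  set β := reducedState A B x u with hβdef
  have hx := fun t => (hcl.isPastSq hω t).1
  have hu := fun t => (hcl.isPastSq hω t).2.1
  have hud := fun t => (hcl.isPastSq hω t).2.2
  have hβ : ∀ t, IsPastSq μ ω t (β t) := hcl.isPastSq_reducedState hω
  have huβ : ∀ (t : ℕ) p, u t p = K *ᵥ β t p := fun t p => by
    rw [hcl.feedback t p, hβdef, reducedState, Matrix.mulVec_add, Matrix.mulVec_sum]
    simp only [Matrix.mulVec_mulVec]
  set F := closedLoopKraus A (reducedInput A B) C σ K with hF
  set R := storedMoment μ σ (fun τ => A ^ D * C τ) β u with hRdef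
  set X := fun t => crossMoment μ (β t) (β t) with hXdef
  have hXpsd : ∀ t, (X t).PosSemidef := fun t => crossMoment_self_posSemidef (hβ t)
  have hR : ∀ t, R (t + 1) = R t - X t + krausMap F (X t) := by
    intro t
    have hstep : ∀ p, β (t + 1) p = (A + reducedInput A B * K) *ᵥ β t p +
        ∑ τ, ω t p τ • ((A ^ D * C τ) *ᵥ u ((t : ℤ) - (τ : ℤ)) p) := fun p => by
      rw [hβdef, reducedState_succ (hcl.dynamics t p), huβ, Matrix.add_mulVec,
        ← Matrix.mulVec_mulVec]
    rw [hRdef, storedMoment_succ hω ((hβ t).mulVec _)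
      (fun k hk => hcl.isPastSq_delay hω t hk) hstep, crossMoment_mulVec_self (hβ t),
      funext (huβ t), crossMoment_mulVec_self (hβ t), ← krausMap_closedLoopKraus]
  obtain ⟨δ, hδ, hδP⟩ := exists_smul_sub_posSemidef h Matrix.isHermitian_one
  have hdec : ∀ t, (X t).trace ≤ δ * (P * R t).trace - δ * (P * R (t + 1)).trace := by
    intro t
    have h1 := trace_mul_nonneg hδP (hXpsd t)
    rw [lyapunovMap_eq_krausMap, ← hF, Matrix.sub_mul, Matrix.trace_sub, Matrix.smul_mul,
      Matrix.trace_smul, Matrix.sub_mul, Matrix.trace_sub, trace_krausMap_mul, Matrix.one_mul,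
      smul_eq_mul] at h1
    rw [hR, Matrix.mul_add, Matrix.mul_sub, Matrix.trace_add, Matrix.trace_sub]
    linarith
  have hRpsd : ∀ t, 0 ≤ δ * (P * R t).trace := fun t =>
    mul_nonneg hδ.le (trace_mul_nonneg hP.posSemidef
      (storedMoment_posSemidef (hβ t) fun k hk => hcl.isPastSq_delay hω t hk))
  have hsum : Summable fun t => (X t).trace := by
    refine summable_of_sum_range_le (c := δ * (P * R 0).trace)
      (fun t => (hXpsd t).trace_nonneg) fun T => ?_
    refine (Finset.sum_le_sum fun t _ => hdec t).trans ?_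
    rw [Finset.sum_range_sub' (fun t => δ * (P * R t).trace)]
    linarith [hRpsd T]
  have hms : ∀ t, meanSquare μ (β t) = ENNReal.ofReal (X t).trace := fun t =>
    meanSquare_eq_trace (hβ t)
  have hβ0 : Tendsto (fun t => meanSquare μ (β t)) atTop (𝓝 0) := by
    simp only [hms]
    simpa using ENNReal.tendsto_ofReal hsum.tendsto_atTop_zero
  have hu0 : Tendsto (fun t : ℕ => meanSquare μ (u t)) atTop (𝓝 0) := by
    simp only [funext (huβ _)]
    exact tendsto_meanSquare_mulVec K hβ0
  refine ⟨fun t => (hu t).measurable, ?_, ?_⟩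
  · calc ∑' t : ℕ, meanSquare μ (u t)
        ≤ ∑' t : ℕ, ENNReal.ofReal (K * Kᵀ).trace * ENNReal.ofReal (X t).trace :=
          ENNReal.tsum_le_tsum fun t => by
            rw [funext (huβ t), ← hms]
            exact meanSquare_mulVec_le K (β t)
      _ = ENNReal.ofReal (K * Kᵀ).trace * ENNReal.ofReal (∑' t, (X t).trace) := by
          rw [ENNReal.tsum_mul_left,
            ENNReal.ofReal_tsum_of_nonneg (fun t => (hXpsd t).trace_nonneg) hsum]
      _ < ∞ := ENNReal.mul_lt_top ENNReal.ofReal_lt_top ENNReal.ofReal_lt_top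
  · have hdet : IsUnit (A ^ D).det := (Matrix.isUnit_iff_isUnit_det _).1 (hA.pow D)
    -- the state is recovered from the reduced state because `A` is invertible
    have hxβ : ∀ t, x t = fun p => (A ^ D)⁻¹ *ᵥ β t p +
        ∑ k : Fin D, (-((A ^ D)⁻¹ * delayGain A B k)) *ᵥ u ((t : ℤ) - ((k : ℤ) + 1)) p := by
      intro t
      funext p
      rw [hβdef, reducedState, Matrix.mulVec_add, Matrix.mulVec_sum, Matrix.mulVec_mulVec,
        Matrix.nonsing_inv_mul _ hdet, Matrix.one_mulVec]
      simp only [Matrix.mulVec_mulVec, Matrix.neg_mulVec, Finset.sum_neg_distrib]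
      abel
    simp only [hxβ]
    have hle := hω.past_le
    refine tendsto_meanSquare_add
      (fun t => (((hβ t).mulVec _).measurable).mono (hle t) le_rfl)
      (tendsto_meanSquare_mulVec _ hβ0)
      (tendsto_meanSquare_sum _ (fun k _ t => (((hud t k).mulVec _).measurable).mono (hle t) le_rfl)
        fun k _ => tendsto_meanSquare_mulVec _ ?_)
    have := tendsto_shift (f := fun s => meanSquare μ (u s)) hu0 (k + 1)
    simpa only [Nat.cast_add, Nat.cast_one] using this

/-- In a stabilized closed loop started with vanishing inputs, `R_0 = ∑_{t<T} (X_t - E_t) + R_T`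
for the stored moments `R_t` and the moments `X_t` of the reduced state, where `E_t` is what the
state and the input at the time `t` contribute, and `R_T → 0`. Summed over trajectories with
`R_0 = e_i e_i'` this gives a joint second-moment matrix with a strict inequality. -/
theorem IsStabilizable.isDelayFreeStabilizable (hA : IsUnit A) (hω : IsNoise μ σ ω)
    (h : IsStabilizable μ A B C ω) : IsDelayFreeStabilizable μ A (reducedInput A B) C ω := by
  obtain ⟨K₀, K, hK⟩ := h
  choose x u hcl using fun i : Fin n =>
    exists_isClosedLoop A B C ω K₀ K ((A ^ D)⁻¹ *ᵥ Pi.single i 1) 0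
  have hdet : IsUnit (A ^ D).det := (Matrix.isUnit_iff_isUnit_det _).1 (hA.pow D)
  set β := fun i => reducedState A B (x i) (u i) with hβdef
  have hβ : ∀ i t, IsPastSq μ ω t (β i t) := fun i => (hcl i).isPastSq_reducedState hω
  have hu : ∀ i (t : ℕ), IsPastSq μ ω t (u i t) := fun i t => ((hcl i).isPastSq hω t).2.1
  have hud : ∀ i (t k : ℕ), k ≤ D → IsPastSq μ ω t (u i ((t : ℤ) - k)) := fun i t k hk =>
    (hcl i).isPastSq_delay hω t hk
  have hu0 : ∀ i, Tendsto (fun t : ℕ => meanSquare μ (u i t)) atTop (𝓝 0) := fun i =>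
    ENNReal.tendsto_atTop_zero_of_tsum_ne_top (hK _ _ _ _ (hcl i)).2.1.ne
  have hle := hω.past_le
  have hβ0 : ∀ i, Tendsto (fun t => meanSquare μ (β i t)) atTop (𝓝 0) := by
    intro i
    refine tendsto_meanSquare_add
      (fun t => ((((hcl i).isPastSq hω t).1.mulVec _).measurable).mono (hle t) le_rfl)
      (tendsto_meanSquare_mulVec _ (hK _ _ _ _ (hcl i)).2.2)
      (tendsto_meanSquare_sum _ (fun k _ t =>
        (((((hcl i).isPastSq hω t).2.2 k).mulVec _).measurable).mono (hle t) le_rfl)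
        fun k _ => tendsto_meanSquare_mulVec _ ?_)
    have := tendsto_shift (f := fun s => meanSquare μ (u i s)) (hu0 i) (k + 1)
    simpa only [Nat.cast_add, Nat.cast_one] using this
  set L := reducedInput A B with hL
  set H := fun τ => A ^ D * C τ with hH
  set R := fun i => storedMoment μ σ H (β i) (u i) with hRdef
  set X := fun i t => crossMoment μ (β i t) (β i t) with hXdef
  set Y := fun i (t : ℕ) => crossMoment μ (u i t) (β i t) with hYdef
  set V := fun i (t : ℕ) => crossMoment μ (u i t) (u i t) with hVdef
  set E := fun i t => A * X i t * Aᵀ + A * (Y i t)ᵀ * Lᵀ + (L * Y i t * Aᵀ + L * V i t * Lᵀ) +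
    ∑ τ, σ τ ^ 2 • (H τ * V i t * (H τ)ᵀ) with hEdef
  have hZ : ∀ i t, IsPastSq μ ω t fun p => A *ᵥ β i t p + L *ᵥ u i t p := fun i t =>
    ((hβ i t).mulVec A).add ((hu i t).mulVec L)
  have hE : ∀ i t, crossMoment μ (fun p => A *ᵥ β i t p + L *ᵥ u i t p)
      (fun p => A *ᵥ β i t p + L *ᵥ u i t p) + ∑ τ, σ τ ^ 2 • (H τ * V i t * (H τ)ᵀ) = E i t := by
    intro i t
    rw [crossMoment_linearCombination (hβ i t) (hu i t), ← crossMoment_transpose (u i t) (β i t)]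
  have hRstep : ∀ i t, R i (t + 1) = R i t - X i t + E i t := by
    intro i t
    rw [← hE]
    exact storedMoment_succ hω (hZ i t) (hud i t) fun p =>
      reducedState_succ ((hcl i).dynamics t p)
  have hpast : ∀ i (k : Fin D), u i (-((k : ℤ) + 1)) = fun _ => 0 := fun i k =>
    funext fun p => (hcl i).init_input k p
  have hR0 : ∀ i, R i 0 = Matrix.vecMulVec (Pi.single i 1) (Pi.single i 1) := by
    intro i
    have hβ00 : β i 0 = fun _ => Pi.single i 1 := by
      funext p
      simp only [hβdef, reducedState, Nat.cast_zero, zero_sub, hpast, (hcl i).init_state,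
        Matrix.mulVec_mulVec, Matrix.mul_nonsing_inv _ hdet, Matrix.one_mulVec,
        Matrix.mulVec_zero, Finset.sum_const_zero, add_zero]
    have hz : ∀ τ : Fin (D + 1), ∑ j ∈ Finset.range τ, H τ *
        crossMoment μ (u i (((0 : ℕ) : ℤ) - 1 - j)) (u i (((0 : ℕ) : ℤ) - 1 - j)) * (H τ)ᵀ = 0 := by
      refine fun τ => Finset.sum_eq_zero fun j hj => ?_
      have hj' := Finset.mem_range.1 hj
      have := hpast i ⟨j, by omega⟩
      rw [show ((0 : ℕ) : ℤ) - 1 - j = -((j : ℤ) + 1) by push_cast; ring, this, crossMoment_const]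
      simp
    simp only [hRdef, storedMoment, hz, smul_zero, Finset.sum_const_zero, add_zero, hβ00,
      crossMoment_const]
  have hRsum : ∀ i T, ∑ t ∈ Finset.range T, X i t - ∑ t ∈ Finset.range T, E i t =
      R i 0 - R i T := by
    intro i T
    rw [← Finset.sum_range_sub', ← Finset.sum_sub_distrib]
    refine Finset.sum_congr rfl fun t _ => ?_
    rw [hRstep]
    abel
  have hRpsd : ∀ i t, (R i t).PosSemidef := fun i t => storedMoment_posSemidef (hβ i t) (hud i t)
  have hRlim : ∀ i, Tendsto (fun t => (R i t).trace) atTop (𝓝 0) := by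
    intro i
    have hj : ∀ (τ : Fin (D + 1)), ∀ j ∈ Finset.range τ, Tendsto (fun t : ℕ =>
        (H τ * crossMoment μ (u i ((t : ℤ) - 1 - j)) (u i ((t : ℤ) - 1 - j)) * (H τ)ᵀ).trace)
        atTop (𝓝 0) := by
      intro τ j hj
      have hj' := Finset.mem_range.1 hj
      have hs : ∀ t : ℕ, (t : ℤ) - 1 - j = (t : ℤ) - ((j + 1 : ℕ) : ℤ) := fun t => by
        push_cast; ring
      simp only [hs]
      have huj := fun t => hud i t (j + 1) (by omega)
      have := tendsto_trace_crossMoment (fun t => (huj t).mulVec (H τ))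
        (tendsto_meanSquare_mulVec (H τ)
          (tendsto_shift (f := fun s => meanSquare μ (u i s)) (hu0 i) (j + 1)))
      simpa only [crossMoment_mulVec_self (huj _)] using this
    have h1 := (tendsto_trace_crossMoment (hβ i) (hβ0 i)).add
      (tendsto_finsetSum Finset.univ fun (τ : Fin (D + 1)) _ =>
        (tendsto_finsetSum (Finset.range τ) (hj τ)).const_mul (σ τ ^ 2))
    simp only [Finset.sum_const_zero, mul_zero, add_zero] at h1
    refine h1.congr fun t => ?_
    simp only [hRdef, storedMoment, Matrix.trace_add, Matrix.trace_sum, Matrix.trace_smul,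
      smul_eq_mul]
  have hRsumlim : Tendsto (fun t => (∑ i, R i t).trace) atTop (𝓝 0) := by
    have := tendsto_finsetSum Finset.univ fun i _ => hRlim i
    simpa only [← Matrix.trace_sum, Finset.sum_const_zero] using this
  obtain ⟨T, hT⟩ := (eventually_posDef_sub Matrix.PosDef.one
    (fun t => Matrix.posSemidef_sum Finset.univ fun i _ => hRpsd i t) hRsumlim).exists
  have hbal : ∑ i, ∑ t ∈ Finset.range T, X i t - ∑ i, ∑ t ∈ Finset.range T, E i t =
      1 - ∑ i, R i T := by
    rw [← Finset.sum_sub_distrib, ← sum_vecMulVec_single, ← Finset.sum_sub_distrib]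
    exact Finset.sum_congr rfl fun i _ => by rw [hRsum, hR0]
  rw [← hbal] at hT
  have hEpsd : (∑ i, ∑ t ∈ Finset.range T, E i t).PosSemidef := by
    refine Matrix.posSemidef_sum _ fun i _ => Matrix.posSemidef_sum _ fun t _ => ?_
    rw [← hE]
    exact (crossMoment_self_posSemidef (hZ i t)).add (Matrix.posSemidef_sum _ fun τ _ =>
      (posSemidef_conj (crossMoment_self_posSemidef (hu i t)) _).smul (sq_nonneg _))
  have hS : (∑ i, ∑ t ∈ Finset.range T, X i t).PosDef := by
    simpa only [sub_add_cancel] using hT.add_posSemidef hEpsd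
  suffices hK' : ∃ K', ((∑ i, ∑ t ∈ Finset.range T, X i t) - krausMap
      (closedLoopKraus A L C σ K') (∑ i, ∑ t ∈ Finset.range T, X i t)).PosDef from
    isDelayFreeStabilizable_of_posDef_sub hω hS hK'.choose_spec
  refine exists_posDef_sub_of_joint (A := A) (L := L) (C := C) (σ := σ)
    (S := ∑ i, ∑ t ∈ Finset.range T, X i t) (G := ∑ i, ∑ t ∈ Finset.range T, Y i t)
    (U := ∑ i, ∑ t ∈ Finset.range T, V i t) hS ?_ ?_
  · intro M
    -- the summed second moments of the error `u - M β`
    have h1 : (∑ i, ∑ t ∈ Finset.range T,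
        crossMoment μ (fun p => (-M) *ᵥ β i t p + (1 : Matrix (Fin m) (Fin m) ℝ) *ᵥ u i t p)
          (fun p => (-M) *ᵥ β i t p + (1 : Matrix (Fin m) (Fin m) ℝ) *ᵥ u i t p)).PosSemidef :=
      Matrix.posSemidef_sum _ fun i _ => Matrix.posSemidef_sum _ fun t _ =>
        crossMoment_self_posSemidef (((hβ i t).mulVec _).add ((hu i t).mulVec _))
    convert h1 using 1
    simp only [crossMoment_linearCombination (hβ _ _) (hu _ _),
      ← crossMoment_transpose (u _ _) (β _ _), Matrix.transpose_sum, Matrix.mul_sum,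
      Matrix.sum_mul, ← Finset.sum_sub_distrib, ← Finset.sum_add_distrib]
    refine Finset.sum_congr rfl fun i _ => Finset.sum_congr rfl fun t _ => ?_
    simp only [hXdef, hYdef, hVdef, Matrix.transpose_neg, Matrix.transpose_one, Matrix.mul_one,
      Matrix.one_mul, Matrix.neg_mul, Matrix.mul_neg, neg_neg]
    abel
  · convert hT using 2
    simp only [hEdef, Finset.sum_add_distrib, Matrix.transpose_sum, Matrix.mul_sum,
      Matrix.sum_mul, Finset.smul_sum]
    congr 1
    rw [Finset.sum_comm]
    refine Finset.sum_congr rfl fun i _ => Finset.sum_comm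

end Stabilization

end DelayStab

end

theorem theorem2 {Ω : Type*} [MeasurableSpace Ω] (μ : Measure Ω) [IsProbabilityMeasure μ]
    {n m D : ℕ} (A : Matrix (Fin n) (Fin n) ℝ) (hA : IsUnit A)
    (B C : Fin (D + 1) → Matrix (Fin n) (Fin m) ℝ)
    (σ : Fin (D + 1) → ℝ) (ω : ℕ → Ω → Fin (D + 1) → ℝ) (hω : DelayStab.IsNoise μ σ ω) :
    List.TFAE [
      DelayStab.IsStabilizable μ A B C ω,
      DelayStab.IsDelayFreeStabilizable μ A (DelayStab.reducedInput A B) C ω,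
      ∀ Q : Matrix (Fin n) (Fin n) ℝ, Q.PosDef →
        ∃ (K : Matrix (Fin m) (Fin n) ℝ) (P : Matrix (Fin n) (Fin n) ℝ), P.PosDef ∧
          P = Q + DelayStab.lyapunovMap A (DelayStab.reducedInput A B) C σ K P,
      ∃ (K : Matrix (Fin m) (Fin n) ℝ) (P : Matrix (Fin n) (Fin n) ℝ), P.PosDef ∧
        (P - DelayStab.lyapunovMap A (DelayStab.reducedInput A B) C σ K P).PosDef] := by
  tfae_have 1 → 2 := fun h => h.isDelayFreeStabilizable hA hω
  tfae_have 2 → 4 := fun h => h.exists_posDef_sub hω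
  tfae_have 4 → 1 := fun ⟨_, _, hP, h⟩ =>
    DelayStab.isStabilizable_of_posDef_sub hA hω hP h
  tfae_have 4 → 3 := by
    rintro ⟨K, P, hP, h⟩ Q hQ
    rw [DelayStab.lyapunovMap_eq_krausMap] at h
    refine ⟨K, ?_⟩
    simp only [DelayStab.lyapunovMap_eq_krausMap]
    exact DelayStab.exists_lyapunov_solution hP h hQ
  tfae_have 3 → 4 := by
    intro h
    obtain ⟨K, P, hP, hPQ⟩ := h 1 .one
    refine ⟨K, P, hP, ?_⟩
    rw [sub_eq_of_eq_add hPQ]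
    exact .one
  tfae_finish
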